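/- Let $m,n_1,n_2,k_1,k_2$ be non-negative integers and let $r_1,r_2>0$ satisfy $r_1^2+r_2^2=1$. For $i=1,2$ let $F_i:\mathbb R^{m+1}\to\mathbb R^{n_i+1}$ be a form of degree $k_i$ (each component is a homogeneous polynomial of degree $k_i$) which restricts to a map $\varphi_i:\mathbb S^m\to\mathbb S^{n_i}(r_i)$ from the unit sphere to the sphere of radius $r_i$ centred at the origin. Let $F=(F_1,F_2):\mathbb R^{m+1}\to\mathbb R^{n_1+n_2+2}$, let $\iota:\mathbb S^{n_1}(r_1)\times\mathbb S^{n_2}(r_2)\to\mathbb S^{n_1+n_2+1}$ be the canonical inclusion, and let $\varphi=\iota\circ(\varphi_1,\varphi_2):\mathbb S^m\to\mathbb S^{n_1+n_2+1}$. Write $\Phi=(\Phi_1,\Phi_2)=F|_{\mathbb S^m}$, where $\Phi_i=F_i|_{\mathbb S^m}$. The unit spheres carry their standard metrics, and the bitension field of a map $\varphi:M\to N$ between Riemannian manifolds is $\tau_2(\varphi)=-\Delta\tau(\varphi)-\operatorname{trace}R^N(d\varphi(\cdot),\tau(\varphi))d\varphi(\cdot)$, where $\tau(\varphi)=\operatorname{trace}\nabla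 d\varphi$ is the tension field, $\Delta=-\operatorname{trace}\nabla^2$ is the rough Laplacian on sections of $\varphi^{-1}TN$, and $R(X,Y)Z=\nabla_X\nabla_YZ-\nabla_Y\nabla_XZ-\nabla_{[X,Y]}Z$. Let $\mathring\Delta=-\sum_i\partial_i^2$, $\mathring d$, $\mathring\nabla$ and $\mathring{\mathrm{grad}}$ be the operators on $\mathbb R^{m+1}$, so that $|\mathring dF|^2=\sum_i|\partial_iF|^2$ and $|\mathring\nabla\mathring dF|^2=\sum_{i,j}|\partial_i\partial_jF|^2$. Then, at every point of $\mathbb S^m$ and regarding $\tau_2(\varphi)$ as a vector of $\mathbb R^{n_1+n_2+2}$, \begin{align*} \tau_2(\varphi)=\;&\mathring\Delta\mathring\Delta F\\ &+\Big(2(mk_1+k_1^2-3k_1-m+3)\mathring\Delta F_1+k_1^2(m+k_1-1)^2\Phi_1,\\ &\qquad 2(mk_2+k_2^2-3k_2-m+3)\mathring\Delta F_2+k_2^2(m+k_2-1)^2\Phi_2\Big)\\ &+2\left(|\mathring dF|^2-k_1^2r_1^2-k_2^2r_2^2\right)\Big(-\mathring\Delta F_1+k_1(1-m-k_1)\Phi_1,\;-\mathring\Delta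 F_2+k_2(1-m-k_2)\Phi_2\Big)\\ &+\Big\{-2\mathring\Delta\left(|\mathring dF|^2\right)-2|\mathring\nabla\mathring dF|^2+|\mathring\Delta F|^2+2(m+2k_1-3)|\mathring dF_1|^2+2(m+2k_2-3)|\mathring dF_2|^2\\ &\qquad-r_1^2k_1^2(m^2+4mk_1-6m+5k_1^2-12k_1+5)-2k_1(m+k_1-1)|\mathring dF_1|^2\\ &\qquad-r_2^2k_2^2(m^2+4mk_2-6m+5k_2^2-12k_2+5)-2k_2(m+k_2-1)|\mathring dF_2|^2\\ &\qquad+2\left(|\mathring dF|^2-k_1^2r_1^2-k_2^2r_2^2\right)^2\Big\}\,\Phi\\ &+2\,\mathring dF\left(\mathring{\mathrm{grad}}\left(|\mathring dF|^2\right)\right)-4\left((k_1-1)|\mathring dF_1|^2+(k_2-1)|\mathring dF_2|^2\right)(k_1\Phi_1,k_2\Phi_2). \end{align*} -/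

import Mathlib

open scoped Manifold ContDiff

namespace BiharmonicForms

noncomputable section

/-- The coordinate space `ℝ^m` with its Euclidean norm. -/
abbrev Euc (m : ℕ) : Type := EuclideanSpace ℝ (Fin m)

/-- The unit sphere `S^m` in `ℝ^{m+1}`. -/
abbrev Sph (m : ℕ) : Type := Metric.sphere (0 : Euc (m + 1)) 1

/-! ### Riemannian geometry in coordinates -/

/-- The partial derivative `∂_i f`. -/
def pd {m : ℕ} {W : Type*} [NormedAddCommGroup W] [NormedSpace ℝ W]
    (i : Fin m) (f : Euc m → W) (x : Euc m) : W :=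
  fderiv ℝ f x (EuclideanSpace.single i 1)

/-- The Christoffel symbol `Γ^k_{ij} = ½ ∑_l g^{kl} (∂_i g_{jl} + ∂_j g_{il} - ∂_l g_{ij})`
of the Levi-Civita connection of the metric with coefficients `g`. -/
def christoffel {m : ℕ} (g : Euc m → Matrix (Fin m) (Fin m) ℝ) (k i j : Fin m) (x : Euc m) : ℝ :=
  (1 / 2) * ∑ l, (g x)⁻¹ k l *
    (pd i (fun y => g y j l) x + pd j (fun y => g y i l) x - pd l (fun y => g y i j) x)

/-- The components of the curvature tensor:
`R(∂_a, ∂_b) ∂_c = ∇_a ∇_b ∂_c - ∇_b ∇_a ∂_c = ∑_d (riemann g d a b c) ∂_d`. -/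
def riemann {m : ℕ} (g : Euc m → Matrix (Fin m) (Fin m) ℝ) (d a b c : Fin m) (x : Euc m) : ℝ :=
  pd a (christoffel g d b c) x - pd b (christoffel g d a c) x
    + ∑ e, (christoffel g e b c x * christoffel g d a e x
      - christoffel g e a c x * christoffel g d b e x)

/-- The curvature `R(X, Y) Z` at the point `x`. -/
def curvature {m : ℕ} (g : Euc m → Matrix (Fin m) (Fin m) ℝ) (x X Y Z : Euc m) : Euc m :=
  WithLp.toLp 2 fun d => ∑ a, ∑ b, ∑ c, riemann g d a b c x * X a * Y b * Z c

/-- The derivative `∇_{∂_i} V` of a section `V` of `φ⁻¹ TN`, for the pull-back by `φ` of the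
Levi-Civita connection of the metric `h` of the target. -/
def pullbackCov {m n : ℕ} (h : Euc n → Matrix (Fin n) (Fin n) ℝ) (φ : Euc m → Euc n)
    (i : Fin m) (V : Euc m → Euc n) (x : Euc m) : Euc n :=
  pd i V x + WithLp.toLp 2 fun c =>
    ∑ a, ∑ b, christoffel h c a b (φ x) * pd i φ x a * V x b

/-- The tension field `τ(φ) = trace_g ∇dφ`, where
`(∇dφ)(∂_i, ∂_j) = ∇_{∂_i} (dφ ∂_j) - dφ (∇_{∂_i} ∂_j)`. -/
def tension {m n : ℕ} (g : Euc m → Matrix (Fin m) (Fin m) ℝ)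
    (h : Euc n → Matrix (Fin n) (Fin n) ℝ) (φ : Euc m → Euc n) (x : Euc m) : Euc n :=
  ∑ i, ∑ j, (g x)⁻¹ i j •
    (pullbackCov h φ i (pd j φ) x - ∑ k, christoffel g k i j x • pd k φ x)

/-- The rough Laplacian `Δ V = - trace_g ∇² V` on sections of `φ⁻¹ TN`, where
`∇² V (∂_i, ∂_j) = ∇_{∂_i} ∇_{∂_j} V - ∇_{∇_{∂_i} ∂_j} V`. -/
def roughLaplacian {m n : ℕ} (g : Euc m → Matrix (Fin m) (Fin m) ℝ)
    (h : Euc n → Matrix (Fin n) (Fin n) ℝ) (φ : Euc m → Euc n) (V : Euc m → Euc n)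
    (x : Euc m) : Euc n :=
  -∑ i, ∑ j, (g x)⁻¹ i j •
    (pullbackCov h φ i (pullbackCov h φ j V) x
      - ∑ k, christoffel g k i j x • pullbackCov h φ k V x)

/-- The bitension field `τ₂(φ) = - Δ τ(φ) - trace_g R^N(dφ ·, τ(φ)) dφ ·` in coordinates. -/
def bitension {m n : ℕ} (g : Euc m → Matrix (Fin m) (Fin m) ℝ)
    (h : Euc n → Matrix (Fin n) (Fin n) ℝ) (φ : Euc m → Euc n) (x : Euc m) : Euc n :=
  -roughLaplacian g h φ (tension g h φ) x
    - ∑ i, ∑ j, (g x)⁻¹ i j •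
        curvature h (φ x) (pd i φ x) (tension g h φ x) (pd j φ x)

/-! ### Riemannian geometry on manifolds -/

/-- A smooth Riemannian metric on the manifold `M`. -/
abbrev RMetric (m : ℕ) (M : Type*) [TopologicalSpace M] [ChartedSpace (Euc m) M]
    [IsManifold (𝓡 m) 1 M] : Type _ :=
  Bundle.ContMDiffRiemannianMetric (𝓡 m) ∞ (Euc m) (fun p : M => TangentSpace (𝓡 m) p)

/-- The coefficients `g_{ij} = g(∂_i, ∂_j)` of a Riemannian metric in the chart around `p`. -/
def metricCoeff {m : ℕ} {M : Type*} [TopologicalSpace M] [ChartedSpace (Euc m) M]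
    [IsManifold (𝓡 m) 1 M] (G : RMetric m M) (p : M) (u : Euc m) : Matrix (Fin m) (Fin m) ℝ :=
  Matrix.of fun i j =>
    G.inner ((chartAt (Euc m) p).symm u)
      (mfderiv (𝓡 m) (𝓡 m) (chartAt (Euc m) p).symm u (EuclideanSpace.single i (1 : ℝ)))
      (mfderiv (𝓡 m) (𝓡 m) (chartAt (Euc m) p).symm u (EuclideanSpace.single j (1 : ℝ)))

/-- The bitension field of a map `φ : (M, G) → (N, H)` at `p`, computed in the charts around `p` and
`φ p`. The result is a tangent vector at `φ p`: an element of `TangentSpace (𝓡 n) (φ p)` is the tuple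
of its components in the chart around `φ p`. -/
def bitensionField {m n : ℕ} {M N : Type*} [TopologicalSpace M] [ChartedSpace (Euc m) M]
    [IsManifold (𝓡 m) 1 M] [TopologicalSpace N] [ChartedSpace (Euc n) N]
    [IsManifold (𝓡 n) 1 N] (G : RMetric m M) (H : RMetric n N) (φ : M → N) (p : M) :
    TangentSpace (𝓡 n) (φ p) :=
  bitension (metricCoeff G p) (metricCoeff H (φ p))
    (chartAt (Euc n) (φ p) ∘ φ ∘ (chartAt (Euc m) p).symm) (chartAt (Euc m) p p)

/-- The differential at `p` of the inclusion `S^m → ℝ^{m+1}`. -/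
def dIncl {m : ℕ} (p : Sph m) : TangentSpace (𝓡 m) p →L[ℝ] Euc (m + 1) :=
  mvfderiv (𝓡 m) (Subtype.val : Sph m → Euc (m + 1)) p

/-- The pull-back `(v, w) ↦ ⟨L v, L w⟩` of the Euclidean inner product. -/
def pullInner {m n : ℕ} (L : Euc m →L[ℝ] Euc n) : Euc m →L[ℝ] Euc m →L[ℝ] ℝ :=
  ((innerSL ℝ : Euc n →L[ℝ] Euc n →L[ℝ] ℝ)).bilinearComp L L

theorem pullInner_apply {m n : ℕ} (L : Euc m →L[ℝ] Euc n) (v w : Euc m) :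
    pullInner L v w = inner ℝ (L v) (L w) := rfl

theorem contDiff_pullInner {m n : ℕ} :
    ContDiff ℝ ∞ (pullInner : (Euc m →L[ℝ] Euc n) → _) := by
  rw [contDiff_clm_apply_iff]
  intro v
  rw [contDiff_clm_apply_iff]
  intro w
  simp only [pullInner_apply]
  exact ContDiff.inner ℝ (by fun_prop) (by fun_prop)

theorem dIncl_injective {m : ℕ} (p : Sph m) : Function.Injective (dIncl p) :=
  have : Fact (Module.finrank ℝ (Euc (m + 1)) = m + 1) := ⟨finrank_euclideanSpace_fin⟩
  injective_mvfderiv_subtypeVal_sphere p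

theorem pullInner_isVonNBounded {m n : ℕ} (L : Euc m →L[ℝ] Euc n) (hL : Function.Injective L) :
    Bornology.IsVonNBounded ℝ {v : Euc m | pullInner L v v < 1} := by
  obtain ⟨K, hK0, hK⟩ := (L : Euc m →ₗ[ℝ] Euc n).exists_antilipschitzWith
    (LinearMap.ker_eq_bot.2 hL)
  refine (NormedSpace.isVonNBounded_closedBall ℝ (Euc m) K).subset fun v hv => ?_
  have h1 : ‖L v‖ < 1 := by
    have : ‖L v‖ ^ 2 < 1 := by rw [← real_inner_self_eq_norm_sq]; exact hv
    nlinarith [norm_nonneg (L v)]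
  have h2 : ‖v‖ ≤ K * ‖L v‖ := by simpa using hK.le_mul_dist v 0
  simp only [Metric.mem_closedBall, dist_zero_right]
  nlinarith [K.2, norm_nonneg (L v)]

/-- The standard metric of the unit sphere, induced from the Euclidean metric. -/
def roundMetric (m : ℕ) : RMetric m (Sph m) where
  inner p := pullInner (dIncl p)
  symm p v w := real_inner_comm (dIncl p w) (dIncl p v)
  pos p v hv :=
    real_inner_self_pos.2 fun h => hv (dIncl_injective p (h.trans (map_zero (dIncl p)).symm))
  isVonNBounded p := pullInner_isVonNBounded (dIncl p) (dIncl_injective p)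
  contMDiff := by
    have : Fact (Module.finrank ℝ (Euc (m + 1)) = m + 1) := ⟨finrank_euclideanSpace_fin⟩
    intro p
    have hc : ContMDiff (𝓡 m) 𝓘(ℝ, Euc (m + 1)) ω (Subtype.val : Sph m → Euc (m + 1)) :=
      contMDiff_coe_sphere
    have key := ContMDiffAt.mfderiv_const (m := ∞) (hc p) le_top
    rw [contMDiffAt_hom_bundle]
    refine ⟨contMDiffAt_id, ?_⟩
    refine (contDiff_pullInner.contMDiff.contMDiffAt.comp p key).congr_of_eventuallyEq ?_
    filter_upwards [(chartAt (Euc m) p).open_source.mem_nhds (mem_chart_source (Euc m) p)] with q hq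
    have hD : ∀ v : Euc m, inTangentCoordinates (𝓡 m) 𝓘(ℝ, Euc (m + 1)) id
        (Subtype.val : Sph m → Euc (m + 1)) (fun r => mfderiv (𝓡 m) 𝓘(ℝ, Euc (m + 1)) Subtype.val r)
        p q v = dIncl q ((trivializationAt (Euc m) (TangentSpace (𝓡 m)) p).symm q v) := by
      intro v
      change (trivializationAt (Euc (m + 1)) (TangentSpace 𝓘(ℝ, Euc (m + 1)))
        (p : Euc (m + 1))).continuousLinearMapAt ℝ (q : Euc (m + 1)) _ = _
      rw [TangentBundle.continuousLinearMapAt_model_space]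
      exact congrArg (dIncl q) (Bundle.Trivialization.symmL_apply (R := ℝ)
        (trivializationAt (Euc m) (TangentSpace (𝓡 m)) p) hq v)
    ext v w
    refine (inCoordinates_apply_eq₂ (F₃ := ℝ) (E₃ := fun _ => ℝ) hq hq (Set.mem_univ _)).trans ?_
    refine Eq.trans ?_ (congrArg₂ (inner ℝ) (hD v) (hD w)).symm
    simp
    rfl

/-! ### Forms and diagonal maps -/

/-- `F : ℝ^m → ℝ^n` is a form of degree `k`: each component is a homogeneous polynomial of
degree `k`. -/
def IsForm {m n : ℕ} (k : ℕ) (F : Euc m → Euc n) : Prop :=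
  ∃ P : Fin n → MvPolynomial (Fin m) ℝ, (∀ j, (P j).IsHomogeneous k) ∧
    ∀ x j, F x j = MvPolynomial.eval (fun i => x i) (P j)

/-- The vector `(a, b)` of `ℝ^{n₁+1} × ℝ^{n₂+1} = ℝ^{n₁+n₂+2}`. -/
def join {n₁ n₂ : ℕ} (a : Euc (n₁ + 1)) (b : Euc (n₂ + 1)) : Euc (n₁ + n₂ + 1 + 1) :=
  WithLp.toLp 2 fun i => Fin.append (fun j => a j) (fun j => b j) (Fin.cast (by omega) i)

theorem norm_join_sq {n₁ n₂ : ℕ} (a : Euc (n₁ + 1)) (b : Euc (n₂ + 1)) :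
    ‖join a b‖ ^ 2 = ‖a‖ ^ 2 + ‖b‖ ^ 2 := by
  simp only [EuclideanSpace.norm_sq_eq, join]
  let f : Fin ((n₁ + 1) + (n₂ + 1)) → ℝ :=
    fun i => ‖Fin.append (fun j => a j) (fun j => b j) i‖ ^ 2
  refine ((finCongr (show n₁ + n₂ + 1 + 1 = (n₁ + 1) + (n₂ + 1) by omega)).sum_comp f).trans
    ((Fin.sum_univ_add f).trans ?_)
  simp only [f, Fin.append_left, Fin.append_right]

/-- The inclusion `S^{n₁}(r₁) × S^{n₂}(r₂) → S^{n₁+n₂+1}` for `r₁² + r₂² = 1`. -/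
def prodIncl {n₁ n₂ : ℕ} {r₁ r₂ : ℝ} (hr : r₁ ^ 2 + r₂ ^ 2 = 1)
    (y : Metric.sphere (0 : Euc (n₁ + 1)) r₁ × Metric.sphere (0 : Euc (n₂ + 1)) r₂) :
    Sph (n₁ + n₂ + 1) :=
  ⟨join y.1 y.2, by
    have h := norm_join_sq (y.1 : Euc (n₁ + 1)) (y.2 : Euc (n₂ + 1))
    rw [mem_sphere_zero_iff_norm.1 y.1.2, mem_sphere_zero_iff_norm.1 y.2.2, hr] at h
    rw [mem_sphere_zero_iff_norm]
    nlinarith [norm_nonneg (join (y.1 : Euc (n₁ + 1)) (y.2 : Euc (n₂ + 1)))]⟩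

/-! ### Operators on `ℝ^m` -/

/-- The Laplacian `Δ = - ∑_i ∂_i ∂_i` of a (vector valued) function, with the geometers' sign. -/
def lap {m : ℕ} {W : Type*} [NormedAddCommGroup W] [NormedSpace ℝ W] (f : Euc m → W) :
    Euc m → W :=
  -Laplacian.laplacian f

/-- `|dF|² = ∑_i |∂_i F|²`. -/
def normSqD {m : ℕ} {W : Type*} [NormedAddCommGroup W] [NormedSpace ℝ W] (F : Euc m → W)
    (x : Euc m) : ℝ :=
  ∑ i, ‖pd i F x‖ ^ 2

/-- `|∇dF|² = ∑_{i,j} |∂_i ∂_j F|²`. -/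
def normSqHess {m : ℕ} {W : Type*} [NormedAddCommGroup W] [NormedSpace ℝ W] (F : Euc m → W)
    (x : Euc m) : ℝ :=
  ∑ i, ∑ j, ‖pd i (pd j F) x‖ ^ 2

end

end BiharmonicForms

open BiharmonicForms

/-! Vectors tangent to the target sphere are read in the ambient Euclidean space. There the
connection of the unit sphere is the ordinary derivative corrected by a multiple of the position
vector (`gauss_apply`), and the curvature is that of constant curvature one (`fderiv_curvature`).
Write Φ for the map as a vector valued function and L for the trace of the Hessian on the domain
sphere. The tension field becomes T = LΦ + |dΦ|²Φ (`fderiv_tension`), and the bitension field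
becomes LT + |dΦ|²T up to a multiple of Φ (`fderiv_bitension`).

On restrictions of ambient functions, L is the Euclidean operator minus radial terms
(`laplaceBeltrami_comp`). Euler's equation turns the radial terms of homogeneous functions into
scalars. This produces every term of the formula except the coefficient of Φ.

That coefficient is never computed directly. The bitension field is tangent to the target sphere,
hence orthogonal to the unit vector Φ. Since the claimed right-hand side differs from it by a
multiple of Φ, it suffices that this side is orthogonal to Φ too. The inner products of `F i` with
its Laplacian, its iterated Laplacian and its derivative, for i = 1, 2, come from differentiating |F
i|², a homogeneous function that is constant on the unit sphere (`inner_lap_of_norm_eq`,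
`inner_lap_lap_of_norm_eq`, `inner_fderiv_of_norm_eq`). -/

namespace BiharmonicForms

/-! ### Calculus of partial derivatives. -/

section PartialDerivatives

variable {m : ℕ} {W : Type*} [NormedAddCommGroup W] [NormedSpace ℝ W]

theorem pd_congr {f g : Euc m → W} {x : Euc m} (h : f =ᶠ[nhds x] g) (i : Fin m) :
    pd i f x = pd i g x := by
  rw [pd, pd, h.fderiv_eq]

theorem contDiffOn_pd {f : Euc m → W} {U : Set (Euc m)} (hf : ContDiffOn ℝ ∞ f U)
    (hU : IsOpen U) (i : Fin m) : ContDiffOn ℝ ∞ (pd i f) U :=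
  (hf.fderiv_of_isOpen hU (m := ∞) (by simp)).clm_apply contDiffOn_const

theorem contDiff_pd {f : Euc m → W} (hf : ContDiff ℝ ∞ f) (i : Fin m) :
    ContDiff ℝ ∞ (pd i f) :=
  (hf.fderiv_right (m := ∞) (by simp)).clm_apply contDiff_const

theorem fderiv_eq_sum_pd (f : Euc m → W) (x v : Euc m) :
    fderiv ℝ f x v = ∑ i, v i • pd i f x := by
  conv_lhs => rw [← (EuclideanSpace.basisFun (Fin m) ℝ).sum_repr v]
  simp [pd]

theorem fderiv_fderiv_single {f : Euc m → W} {x : Euc m} (hf : ContDiffAt ℝ ∞ f x)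
    (i j : Fin m) :
    pd i (pd j f) x =
      fderiv ℝ (fderiv ℝ f) x (EuclideanSpace.single i 1) (EuclideanSpace.single j 1) := by
  have h : DifferentiableAt ℝ (fderiv ℝ f) x :=
    (hf.fderiv_right (m := ∞) (by simp)).differentiableAt (by simp)
  have h2 : fderiv ℝ (pd j f) x = (fderiv ℝ (fderiv ℝ f) x).flip (EuclideanSpace.single j 1) := by
    have := h.hasFDerivAt.clm_apply (hasFDerivAt_const (EuclideanSpace.single j (1 : ℝ)) x)
    refine this.fderiv.trans ?_
    ext v
    simp
  rw [pd, h2]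
  rfl

theorem fderiv_fderiv_symm {f : Euc m → W} {x : Euc m} (hf : ContDiffAt ℝ ∞ f x) (v w : Euc m) :
    fderiv ℝ (fderiv ℝ f) x v w = fderiv ℝ (fderiv ℝ f) x w v :=
  hf.isSymmSndFDerivAt (by
    simpa using WithTop.coe_le_coe.2 (le_top : (2 : ℕ∞) ≤ ⊤)) v w

theorem pd_comm {f : Euc m → W} {x : Euc m} (hf : ContDiffAt ℝ ∞ f x) (i j : Fin m) :
    pd i (pd j f) x = pd j (pd i f) x := by
  rw [fderiv_fderiv_single hf, fderiv_fderiv_single hf, fderiv_fderiv_symm hf]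

theorem fderiv_fderiv_eq_sum {f : Euc m → W} {x : Euc m} (hf : ContDiffAt ℝ ∞ f x)
    (v w : Euc m) :
    fderiv ℝ (fderiv ℝ f) x v w = ∑ i, ∑ j, (v i * w j) • pd i (pd j f) x := by
  conv_lhs => rw [← (EuclideanSpace.basisFun (Fin m) ℝ).sum_repr v,
    ← (EuclideanSpace.basisFun (Fin m) ℝ).sum_repr w]
  simp only [fderiv_fderiv_single hf]
  simp only [EuclideanSpace.basisFun_repr, EuclideanSpace.basisFun_apply, map_sum, map_smul,
    sum_apply, smul_apply, Finset.smul_sum, smul_smul]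
  rw [Finset.sum_comm]
  exact Finset.sum_congr rfl fun i _ => Finset.sum_congr rfl fun j _ => by rw [mul_comm]

theorem pd_add {f g : Euc m → W} {x : Euc m} (hf : DifferentiableAt ℝ f x)
    (hg : DifferentiableAt ℝ g x) (i : Fin m) :
    pd i (fun y => f y + g y) x = pd i f x + pd i g x := by
  simp only [pd, fderiv_fun_add hf hg]; rfl

theorem pd_sub {f g : Euc m → W} {x : Euc m} (hf : DifferentiableAt ℝ f x)
    (hg : DifferentiableAt ℝ g x) (i : Fin m) :
    pd i (fun y => f y - g y) x = pd i f x - pd i g x := by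
  simp only [pd, fderiv_fun_sub hf hg]; rfl

theorem pd_sum {ι : Type*} {s : Finset ι} {f : ι → Euc m → W} {x : Euc m}
    (hf : ∀ a ∈ s, DifferentiableAt ℝ (f a) x) (i : Fin m) :
    pd i (fun y => ∑ a ∈ s, f a y) x = ∑ a ∈ s, pd i (f a) x := by
  simp only [pd, fderiv_fun_sum hf, sum_apply]

theorem pd_smul {q : Euc m → ℝ} {f : Euc m → W} {x : Euc m} (hq : DifferentiableAt ℝ q x)
    (hf : DifferentiableAt ℝ f x) (i : Fin m) :
    pd i (fun y => q y • f y) x = q x • pd i f x + pd i q x • f x := by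
  simp [pd, fderiv_fun_smul hq hf]

theorem pd_const_smul {f : Euc m → W} {x : Euc m} (c : ℝ)
    (hf : DifferentiableAt ℝ f x) (i : Fin m) :
    pd i (fun y => c • f y) x = c • pd i f x := by
  simp [pd, fderiv_fun_const_smul hf]

theorem pd_inner {V : Type*} [NormedAddCommGroup V] [InnerProductSpace ℝ V] {f g : Euc m → V}
    {x : Euc m} (hf : DifferentiableAt ℝ f x) (hg : DifferentiableAt ℝ g x) (i : Fin m) :
    pd i (fun y => inner ℝ (f y) (g y)) x = inner ℝ (f x) (pd i g x) + inner ℝ (pd i f x) (g x) := by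
  simp only [pd, fderiv_inner_apply ℝ hf hg]

theorem pd_clm_comp {V : Type*} [NormedAddCommGroup V] [NormedSpace ℝ V] (L : W →L[ℝ] V)
    {f : Euc m → W} {x : Euc m} (hf : DifferentiableAt ℝ f x) (i : Fin m) :
    pd i (fun y => L (f y)) x = L (pd i f x) := by
  have h := (L.hasFDerivAt.comp x hf.hasFDerivAt).fderiv
  simp only [pd]
  exact congrArg (fun T => T (EuclideanSpace.single i (1 : ℝ))) h

theorem pd_comp {N : ℕ} {f : Euc N → W} {X : Euc m → Euc N} {u : Euc m}
    (hf : DifferentiableAt ℝ f (X u)) (hX : DifferentiableAt ℝ X u) (i : Fin m) :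
    pd i (fun y => f (X y)) u = fderiv ℝ f (X u) (pd i X u) := by
  have h := (hf.hasFDerivAt.comp u hX.hasFDerivAt).fderiv
  simp only [pd]
  exact congrArg (fun T => T (EuclideanSpace.single i (1 : ℝ))) h

/-- Used with `f` a parametrisation of the target sphere and `V` a section in coordinates: the
second derivative of `f` will supply the Christoffel symbols. -/
theorem pd_fderiv_comp {N : ℕ} {f : Euc N → W} {X V : Euc m → Euc N} {u : Euc m}
    (hf : ContDiffAt ℝ ∞ f (X u)) (hX : DifferentiableAt ℝ X u) (hV : DifferentiableAt ℝ V u)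
    (i : Fin m) :
    pd i (fun y => fderiv ℝ f (X y) (V y)) u =
      fderiv ℝ (fderiv ℝ f) (X u) (pd i X u) (V u) + fderiv ℝ f (X u) (pd i V u) := by
  have hf' : DifferentiableAt ℝ (fderiv ℝ f) (X u) :=
    (hf.fderiv_right (m := ∞) (by simp)).differentiableAt (by simp)
  have h := ((hf'.hasFDerivAt.comp u hX.hasFDerivAt).clm_apply hV.hasFDerivAt).fderiv
  simp only [pd]
  refine (congrArg (fun T => T (EuclideanSpace.single i (1 : ℝ))) h).trans ?_
  simp [add_comm]

theorem pd_pd_comp {N : ℕ} {f : Euc N → W} {X : Euc m → Euc N} (hf : ContDiff ℝ ∞ f)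
    (hX : ContDiff ℝ ∞ X) (u : Euc m) (i j : Fin m) :
    pd i (pd j fun y => f (X y)) u =
      fderiv ℝ (fderiv ℝ f) (X u) (pd i X u) (pd j X u) + fderiv ℝ f (X u) (pd i (pd j X) u) := by
  have h : pd j (fun y => f (X y)) = fun u => fderiv ℝ f (X u) (pd j X u) := by
    funext y
    exact pd_comp (hf.differentiable (by simp) _) (hX.differentiable (by simp) _) j
  rw [h]
  exact pd_fderiv_comp hf.contDiffAt (hX.differentiable (by simp) _)
    ((contDiff_pd hX j).differentiable (by simp) _) i

end PartialDerivatives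

/-! ### Smoothness of the inverse metric and of the Christoffel symbols. -/

section Smoothness

theorem contDiffOn_det {E ι : Type*} [NormedAddCommGroup E] [NormedSpace ℝ E] [Fintype ι]
    [DecidableEq ι] {A : E → Matrix ι ι ℝ} {U : Set E}
    (hA : ∀ i j, ContDiffOn ℝ ∞ (fun x => A x i j) U) : ContDiffOn ℝ ∞ (fun x => (A x).det) U := by
  simp only [Matrix.det_apply]
  refine ContDiffOn.sum fun σ _ => ?_
  have h : ContDiffOn ℝ ∞ (fun x => ∏ i, A x (σ i) i) U := contDiffOn_prod fun i _ => hA _ _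
  simp only [Units.smul_def, ← Int.cast_smul_eq_zsmul ℝ]
  exact h.const_smul _

/-- Cramer's rule: each entry is a determinant in the entries of `A`, divided by `det A`. -/
theorem contDiffOn_matrix_inv {E ι : Type*} [NormedAddCommGroup E] [NormedSpace ℝ E] [Fintype ι]
    [DecidableEq ι] {A : E → Matrix ι ι ℝ} {U : Set E}
    (hA : ∀ i j, ContDiffOn ℝ ∞ (fun x => A x i j) U) (hdet : ∀ x ∈ U, (A x).det ≠ 0) (i j : ι) :
    ContDiffOn ℝ ∞ (fun x => (A x)⁻¹ i j) U := by
  simp only [Matrix.inv_def, Ring.inverse_eq_inv', Matrix.smul_apply, smul_eq_mul,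
    Matrix.adjugate_apply]
  refine ((contDiffOn_det hA).inv hdet).mul (contDiffOn_det fun a b => ?_)
  by_cases h : a = j
  · subst h; simpa using contDiffOn_const
  · simpa [Matrix.updateRow_apply, h] using hA a b

variable {m : ℕ} {g : Euc m → Matrix (Fin m) (Fin m) ℝ}

theorem contDiff_christoffel (hg : ∀ i j, ContDiff ℝ ∞ fun x => g x i j)
    (hdet : ∀ x, (g x).det ≠ 0) (k i j : Fin m) : ContDiff ℝ ∞ (christoffel g k i j) := by
  have hinv : ∀ i j, ContDiff ℝ ∞ fun x => (g x)⁻¹ i j := fun i j => contDiffOn_univ.1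
    (contDiffOn_matrix_inv (fun i j => (hg i j).contDiffOn) (fun x _ => hdet x) i j)
  have hpd : ∀ l i j, ContDiff ℝ ∞ fun x => pd l (fun y => g y i j) x :=
    fun l i j => contDiff_pd (hg i j) l
  exact contDiff_const.mul (ContDiff.sum fun l _ =>
    (hinv k l).mul (((hpd _ _ _).add (hpd _ _ _)).sub (hpd _ _ _)))

end Smoothness

/-! ### Extrinsic geometry of the unit sphere: Gauss formula and Gauss equation. -/

/-- A smooth immersion of `ℝ^m` into the unit sphere of `ℝ^{m+1}`. -/
structure IsSphereParam {m : ℕ} (X : Euc m → Euc (m + 1)) : Prop where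
  contDiff : ContDiff ℝ ∞ X
  norm_eq : ∀ u, ‖X u‖ = 1
  injective : ∀ u, Function.Injective (fderiv ℝ X u)

/-- The first fundamental form of `X`. -/
noncomputable def gram {m N : ℕ} (X : Euc m → Euc N) (u : Euc m) : Matrix (Fin m) (Fin m) ℝ :=
  Matrix.of fun i j => inner ℝ (pd i X u) (pd j X u)

namespace IsSphereParam

variable {m : ℕ} {X : Euc m → Euc (m + 1)}

theorem differentiableAt (hX : IsSphereParam X) (u : Euc m) : DifferentiableAt ℝ X u :=
  hX.contDiff.differentiable (by simp) u

theorem differentiableAt_pd (hX : IsSphereParam X) (i : Fin m) (u : Euc m) :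
    DifferentiableAt ℝ (pd i X) u :=
  (contDiff_pd hX.contDiff i).differentiable (by simp) u

theorem inner_self (hX : IsSphereParam X) (u : Euc m) : inner ℝ (X u) (X u) = (1 : ℝ) := by
  rw [real_inner_self_eq_norm_sq, hX.norm_eq, one_pow]

theorem inner_pd (hX : IsSphereParam X) (u : Euc m) (i : Fin m) :
    inner ℝ (X u) (pd i X u) = (0 : ℝ) := by
  have h := pd_inner (hX.differentiableAt u) (hX.differentiableAt u) i
  have h' : (fun y => inner ℝ (X y) (X y)) = fun _ => (1 : ℝ) := funext hX.inner_self
  rw [h', real_inner_comm (X u) (pd i X u)] at h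
  have h0 : pd i (fun _ : Euc m => (1 : ℝ)) u = 0 := by simp [pd]
  linarith

theorem inner_fderiv (hX : IsSphereParam X) (u v : Euc m) :
    inner ℝ (X u) (fderiv ℝ X u v) = (0 : ℝ) := by
  rw [fderiv_eq_sum_pd, inner_sum]
  simp [inner_smul_right, hX.inner_pd]

theorem linearIndependent_pd (hX : IsSphereParam X) (u : Euc m) :
    LinearIndependent ℝ fun i => pd i X u := by
  have h := (EuclideanSpace.basisFun (Fin m) ℝ).toBasis.linearIndependent.map'
    (fderiv ℝ X u : Euc m →ₗ[ℝ] Euc (m + 1)) (LinearMap.ker_eq_bot.2 (hX.injective u))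
  have h' : (fun i => pd i X u) =
      (fderiv ℝ X u : Euc m →ₗ[ℝ] Euc (m + 1)) ∘ (EuclideanSpace.basisFun (Fin m) ℝ).toBasis := by
    funext i
    simp [pd]
  rw [h']
  exact h

theorem det_gram_ne_zero (hX : IsSphereParam X) (u : Euc m) : (gram X u).det ≠ 0 :=
  (Matrix.posDef_gram_of_linearIndependent (hX.linearIndependent_pd u)).det_pos.ne'

theorem contDiff_gram (hX : IsSphereParam X) (i j : Fin m) : ContDiff ℝ ∞ fun u => gram X u i j :=
  (contDiff_pd hX.contDiff i).inner ℝ (contDiff_pd hX.contDiff j)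

theorem contDiff_gram_inv (hX : IsSphereParam X) (i j : Fin m) :
    ContDiff ℝ ∞ fun u => (gram X u)⁻¹ i j :=
  contDiffOn_univ.1 (contDiffOn_matrix_inv (fun i j => (hX.contDiff_gram i j).contDiffOn)
    (fun u _ => hX.det_gram_ne_zero u) i j)

theorem contDiff_christoffel (hX : IsSphereParam X) (k i j : Fin m) :
    ContDiff ℝ ∞ (christoffel (gram X) k i j) :=
  BiharmonicForms.contDiff_christoffel hX.contDiff_gram hX.det_gram_ne_zero k i j

theorem _root_.BiharmonicForms.gram_symm {m N : ℕ} (X : Euc m → Euc N) (u : Euc m)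
    (i j : Fin m) : gram X u i j = gram X u j i := by
  simp only [gram, Matrix.of_apply]
  exact real_inner_comm _ _

theorem _root_.BiharmonicForms.gram_inv_symm {m N : ℕ} (X : Euc m → Euc N) (u : Euc m)
    (i j : Fin m) : (gram X u)⁻¹ i j = (gram X u)⁻¹ j i := by
  have h : (gram X u).transpose = gram X u := by
    ext i j; exact gram_symm X u j i
  conv_lhs => rw [← h, ← Matrix.transpose_nonsing_inv]
  rfl

theorem sum_gram_mul_inv (hX : IsSphereParam X) (u : Euc m) (i k : Fin m) :
    ∑ j, gram X u i j * (gram X u)⁻¹ j k = if i = k then 1 else 0 := by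
  rw [← Matrix.mul_apply, Matrix.mul_nonsing_inv _ (isUnit_iff_ne_zero.2 (hX.det_gram_ne_zero u)),
    Matrix.one_apply]

/-- A vector orthogonal to the sphere parametrised by `X` and to `X` itself vanishes. -/
theorem eq_zero_of_inner_eq_zero (hX : IsSphereParam X) (u : Euc m) {r : Euc (m + 1)}
    (h : ∀ i, inner ℝ (pd i X u) r = (0 : ℝ))
    (h0 : inner ℝ (X u) r = (0 : ℝ)) : r = 0 := by
  set K : Submodule ℝ (Euc (m + 1)) := Submodule.span ℝ (Set.range fun i => pd i X u)
  have hK : Module.finrank ℝ K = m := by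
    simpa using finrank_span_eq_card (hX.linearIndependent_pd u)
  -- The tangent space is a hyperplane, so its orthogonal complement is the line through `X u`, and
  -- `r` is a multiple of `X u`.
  have hK' : Module.finrank ℝ Kᗮ = 1 := by
    have := K.finrank_add_finrank_orthogonal
    rw [hK, finrank_euclideanSpace_fin] at this
    omega
  have hmem : ∀ w : Euc (m + 1), (∀ i, inner ℝ (pd i X u) w = (0 : ℝ)) → w ∈ Kᗮ := by
    intro w hw
    rw [Submodule.mem_orthogonal]
    intro v hv
    induction hv using Submodule.span_induction with
    | mem x hx => obtain ⟨i, rfl⟩ := hx; exact hw i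
    | zero => simp
    | add x y _ _ hx hy => rw [inner_add_left, hx, hy, add_zero]
    | smul a x _ hx => rw [inner_smul_left, hx, mul_zero]
  have hXne : X u ≠ 0 := fun h => by simpa [h] using hX.norm_eq u
  let x' : Kᗮ := ⟨X u, hmem _ fun i => by rw [real_inner_comm]; exact hX.inner_pd u i⟩
  obtain ⟨c, hc⟩ := (finrank_eq_one_iff_of_nonzero' x' (fun h => hXne (congrArg Subtype.val h))).1 hK'
    ⟨r, hmem r h⟩
  have hc : c • X u = r := congrArg Subtype.val hc
  rw [← hc, inner_smul_right, hX.inner_self, mul_one] at h0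
  rw [← hc, h0, zero_smul]

/-- The tangent vectors `∂_i X` and the normal `X` resolve the identity of `ℝ^{m+1}`. -/
theorem resolution (hX : IsSphereParam X) (u : Euc m) (w : Euc (m + 1)) :
    w = ∑ i, (∑ j, (gram X u)⁻¹ i j * inner ℝ (pd j X u) w) • pd i X u + inner ℝ (X u) w • X u := by
  rw [← sub_eq_zero]
  refine hX.eq_zero_of_inner_eq_zero u (fun k => ?_) ?_
  · rw [inner_sub_right, inner_add_right, inner_smul_right,
      real_inner_comm (X u) (pd k X u), hX.inner_pd, mul_zero,
      add_zero, inner_sum]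
    simp only [inner_smul_right, Finset.sum_mul]
    rw [Finset.sum_comm]
    have h : ∀ j, ∑ i, (gram X u)⁻¹ i j * inner ℝ (pd j X u) w * inner ℝ (pd k X u) (pd i X u)
        = (if k = j then 1 else 0) * inner ℝ (pd j X u) w := by
      intro j
      rw [← hX.sum_gram_mul_inv u k j, Finset.sum_mul]
      refine Finset.sum_congr rfl fun i _ => ?_
      simp only [gram, Matrix.of_apply]
      ring
    simp [h]
  · rw [inner_sub_right, inner_add_right, inner_smul_right, hX.inner_self, inner_sum]
    simp [inner_smul_right, hX.inner_pd]

theorem pd_gram (hX : IsSphereParam X) (u : Euc m) (i j l : Fin m) :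
    pd i (fun y => gram X y j l) u =
      inner ℝ (pd j X u) (pd i (pd l X) u) + inner ℝ (pd l X u) (pd i (pd j X) u) := by
  rw [real_inner_comm (pd i (pd j X) u)]
  exact pd_inner (hX.differentiableAt_pd j u) (hX.differentiableAt_pd l u) i

theorem pd_pd_comm (hX : IsSphereParam X) (u : Euc m) (i j : Fin m) :
    pd i (pd j X) u = pd j (pd i X) u :=
  pd_comm hX.contDiff.contDiffAt i j

/-- Expanding the three metric derivatives gives six inner products. By symmetry of second
derivatives, four of them cancel in pairs and the other two are equal. -/
theorem christoffel_eq (hX : IsSphereParam X) (u : Euc m) (k i j : Fin m) :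
    christoffel (gram X) k i j u =
      ∑ l, (gram X u)⁻¹ k l * inner ℝ (pd l X u) (pd i (pd j X) u) := by
  rw [christoffel, Finset.mul_sum]
  refine Finset.sum_congr rfl fun l _ => ?_
  rw [hX.pd_gram, hX.pd_gram, hX.pd_gram, hX.pd_pd_comm u l i, hX.pd_pd_comm u l j,
    hX.pd_pd_comm u j i]
  ring

/-- Differentiate the orthogonality of `X` and `∂_j X`: this is the second fundamental form of the
sphere. -/
theorem inner_pd_pd (hX : IsSphereParam X) (u : Euc m) (i j : Fin m) :
    inner ℝ (X u) (pd i (pd j X) u) = -gram X u i j := by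
  have h := pd_inner (hX.differentiableAt u) (hX.differentiableAt_pd j u) i
  have h' : (fun y => inner ℝ (X y) (pd j X y)) = fun _ => (0 : ℝ) :=
    funext fun y => hX.inner_pd y j
  have h0 : pd i (fun _ : Euc m => (0 : ℝ)) u = 0 := by simp [pd]
  rw [h', h0] at h
  simp only [gram, Matrix.of_apply]
  linarith

/-- The Gauss formula for the unit sphere. -/
theorem gauss (hX : IsSphereParam X) (u : Euc m) (i j : Fin m) :
    pd i (pd j X) u = ∑ k, christoffel (gram X) k i j u • pd k X u - gram X u i j • X u := by
  conv_lhs => rw [hX.resolution u (pd i (pd j X) u), hX.inner_pd_pd, neg_smul, ← sub_eq_add_neg]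
  simp only [hX.christoffel_eq]

theorem _root_.BiharmonicForms.inner_fderiv_fderiv {m N : ℕ} (X : Euc m → Euc N) (u y z : Euc m) :
    inner ℝ (fderiv ℝ X u y) (fderiv ℝ X u z) = ∑ b, ∑ c, y b * z c * gram X u b c := by
  rw [fderiv_eq_sum_pd X u y, fderiv_eq_sum_pd X u z, sum_inner]
  simp only [inner_sum, gram, Matrix.of_apply]
  refine Finset.sum_congr rfl fun b _ => Finset.sum_congr rfl fun c _ => ?_
  rw [real_inner_smul_left, real_inner_smul_right]
  ring

/-- The Gauss formula for arbitrary tangent vectors. -/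
theorem gauss_apply (hX : IsSphereParam X) (u v w : Euc m) :
    fderiv ℝ (fderiv ℝ X) u v w =
      fderiv ℝ X u (WithLp.toLp 2 fun c => ∑ a, ∑ b, christoffel (gram X) c a b u * v a * w b)
        - inner ℝ (fderiv ℝ X u v) (fderiv ℝ X u w) • X u := by
  rw [fderiv_fderiv_eq_sum hX.contDiff.contDiffAt, fderiv_eq_sum_pd X u (WithLp.toLp 2 _),
    inner_fderiv_fderiv]
  simp only [hX.gauss, smul_sub, Finset.sum_sub_distrib, Finset.smul_sum, Finset.sum_smul,
    smul_smul]
  congr 1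
  rw [Finset.sum_congr rfl fun a _ => Finset.sum_comm, Finset.sum_comm]
  refine Finset.sum_congr rfl fun c _ => Finset.sum_congr rfl fun a _ =>
    Finset.sum_congr rfl fun b _ => ?_
  congr 1; ring

/-- The Gauss equation: the unit sphere has constant curvature one. -/
theorem riemann_eq (hX : IsSphereParam X) (u : Euc m) (a b c : Fin m) :
    ∑ d, riemann (gram X) d a b c u • pd d X u =
      gram X u b c • pd a X u - gram X u a c • pd b X u := by
  have hΓ : ∀ k i j, DifferentiableAt ℝ (christoffel (gram X) k i j) u :=
    fun k i j => (hX.contDiff_christoffel k i j).differentiable (by simp) u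
  have hg : ∀ i j, DifferentiableAt ℝ (fun y => gram X y i j) u :=
    fun i j => (hX.contDiff_gram i j).differentiable (by simp) u
  -- the third derivatives of `X`, up to the direction of `X`
  have key : ∀ a b, ∃ s : ℝ, pd a (pd b (pd c X)) u =
      ∑ d, (pd a (christoffel (gram X) d b c) u
        + ∑ e, christoffel (gram X) e b c u * christoffel (gram X) d a e u) • pd d X u
      - gram X u b c • pd a X u + s • X u := by
    intro a b
    have h1 : pd b (pd c X) = fun y =>
        ∑ k, christoffel (gram X) k b c y • pd k X y - gram X y b c • X y :=
      funext fun y => hX.gauss y b c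
    have h2 : ∀ k ∈ Finset.univ, DifferentiableAt ℝ
        (fun y => christoffel (gram X) k b c y • pd k X y) u :=
      fun k _ => (hΓ k b c).fun_smul (hX.differentiableAt_pd k u)
    -- The part along `X` has two sources: the normal part of the second derivatives of `X`,
    -- weighted by Christoffel symbols, and the derivative of the metric coefficient in the Gauss
    -- formula.
    refine ⟨-(∑ e, christoffel (gram X) e b c u * gram X u a e)
      - pd a (fun y => gram X y b c) u, ?_⟩
    rw [h1, pd_sub (DifferentiableAt.fun_sum h2) ((hg b c).fun_smul (hX.differentiableAt u)),
      pd_sum h2, pd_smul (hg b c) (hX.differentiableAt u)]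
    simp only [pd_smul (hΓ _ b c) (hX.differentiableAt_pd _ u), hX.gauss, Finset.sum_add_distrib,
      smul_sub, Finset.smul_sum, Finset.sum_sub_distrib, add_smul, sub_smul, Finset.sum_smul,
      neg_smul, smul_smul]
    rw [Finset.sum_comm]
    module
  obtain ⟨s, hs⟩ := key a b
  obtain ⟨t, ht⟩ := key b a
  have hcomm : pd a (pd b (pd c X)) u = pd b (pd a (pd c X)) u :=
    pd_comm (contDiff_pd hX.contDiff c).contDiffAt a b
  rw [hs, ht] at hcomm
  have hR : ∑ d, riemann (gram X) d a b c u • pd d X u - (gram X u b c • pd a X u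
      - gram X u a c • pd b X u) = (t - s) • X u := by
    simp only [riemann, Finset.sum_sub_distrib, add_smul, sub_smul, Finset.sum_add_distrib]
      at hcomm ⊢
    rw [← sub_eq_zero] at hcomm ⊢
    refine Eq.trans ?_ hcomm
    module
  -- The left side of `hR` is tangential, so pairing with `X u` kills the unknown normal
  -- coefficient.
  have hst : t - s = 0 := by
    have h := congrArg (fun w => inner ℝ (X u) w) hR
    simp only [inner_sub_right, inner_sum, inner_smul_right, hX.inner_pd, hX.inner_self, mul_zero,
      Finset.sum_const_zero, sub_zero, mul_one] at h
    exact h.symm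
  rw [hst, zero_smul, sub_eq_zero] at hR
  exact hR

theorem fderiv_curvature (hX : IsSphereParam X) (u v w z : Euc m) :
    fderiv ℝ X u (curvature (gram X) u v w z) =
      inner ℝ (fderiv ℝ X u w) (fderiv ℝ X u z) • fderiv ℝ X u v
        - inner ℝ (fderiv ℝ X u v) (fderiv ℝ X u z) • fderiv ℝ X u w := by
  have h1 : fderiv ℝ X u (curvature (gram X) u v w z) =
      ∑ a, ∑ b, ∑ c, (v a * w b * z c) • ∑ d, riemann (gram X) d a b c u • pd d X u := by
    rw [fderiv_eq_sum_pd]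
    simp only [curvature, Finset.sum_smul, Finset.smul_sum, smul_smul]
    rw [Finset.sum_comm]
    refine Finset.sum_congr rfl fun a _ => ?_
    rw [Finset.sum_comm]
    refine Finset.sum_congr rfl fun b _ => ?_
    rw [Finset.sum_comm]
    refine Finset.sum_congr rfl fun c _ => Finset.sum_congr rfl fun d _ => ?_
    congr 1; ring
  rw [h1, inner_fderiv_fderiv, inner_fderiv_fderiv, fderiv_eq_sum_pd X u v, fderiv_eq_sum_pd X u w]
  simp only [hX.riemann_eq, smul_sub, Finset.sum_sub_distrib, Finset.sum_smul, Finset.smul_sum,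
    smul_smul, Finset.sum_mul]
  congr 1
  · refine Finset.sum_congr rfl fun a _ => Finset.sum_congr rfl fun b _ =>
      Finset.sum_congr rfl fun c _ => ?_
    congr 1; ring
  · rw [Finset.sum_comm]
    refine Finset.sum_congr rfl fun b _ => Finset.sum_congr rfl fun a _ =>
      Finset.sum_congr rfl fun c _ => ?_
    congr 1; ring

end IsSphereParam

/-! ### Tension and bitension fields of a map into the sphere, seen in the ambient space. -/

/-- The Laplace-Beltrami operator `trace_g ∇d` on vector valued functions. -/
noncomputable def laplaceBeltrami {m : ℕ} {W : Type*} [NormedAddCommGroup W] [NormedSpace ℝ W]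
    (g : Euc m → Matrix (Fin m) (Fin m) ℝ) (f : Euc m → W) (u : Euc m) : W :=
  ∑ i, ∑ j, (g u)⁻¹ i j • (pd i (pd j f) u - ∑ k, christoffel g k i j u • pd k f u)

/-- The squared norm `|dΦ|²` with respect to the metric `g`. -/
noncomputable def energy {m N : ℕ} (g : Euc m → Matrix (Fin m) (Fin m) ℝ) (Φ : Euc m → Euc N)
    (u : Euc m) : ℝ :=
  ∑ i, ∑ j, (g u)⁻¹ i j * inner ℝ (pd i Φ u) (pd j Φ u)

section

variable {m n : ℕ} {X : Euc m → Euc (m + 1)} {Y : Euc n → Euc (n + 1)} {U : Set (Euc m)}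
  {ψ V : Euc m → Euc n} {Φ T : Euc m → Euc (n + 1)}

theorem contDiffOn_toLp {E : Type*} [NormedAddCommGroup E] [NormedSpace ℝ E] {f : E → Fin n → ℝ}
    {s : Set E} (hf : ∀ c, ContDiffOn ℝ ∞ (fun x => f x c) s) :
    ContDiffOn ℝ ∞ (fun x => (WithLp.toLp 2 (f x) : Euc n)) s :=
  (contDiffOn_euclidean (𝕜 := ℝ)).2 hf

theorem contDiffOn_pullbackCov (hY : IsSphereParam Y) (hU : IsOpen U)
    (hψ : ContDiffOn ℝ ∞ ψ U) (hV : ContDiffOn ℝ ∞ V U) (i : Fin m) :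
    ContDiffOn ℝ ∞ (pullbackCov (gram Y) ψ i V) U := by
  refine (contDiffOn_pd hV hU i).add (contDiffOn_toLp fun c => ?_)
  refine ContDiffOn.sum fun a _ => ContDiffOn.sum fun b _ => ?_
  exact (((hY.contDiff_christoffel c a b).comp_contDiffOn hψ).mul
    ((contDiffOn_euclidean (𝕜 := ℝ)).1 (contDiffOn_pd hψ hU i) a)).mul
    ((contDiffOn_euclidean (𝕜 := ℝ)).1 hV b)

theorem contDiffOn_tension (hX : IsSphereParam X) (hY : IsSphereParam Y) (hU : IsOpen U)
    (hψ : ContDiffOn ℝ ∞ ψ U) : ContDiffOn ℝ ∞ (tension (gram X) (gram Y) ψ) U := by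
  refine ContDiffOn.sum fun i _ => ContDiffOn.sum fun j _ => ?_
  refine (hX.contDiff_gram_inv i j).contDiffOn.smul
    ((contDiffOn_pullbackCov hY hU hψ (contDiffOn_pd hψ hU j) i).sub ?_)
  exact ContDiffOn.sum fun k _ =>
    (hX.contDiff_christoffel k i j).contDiffOn.smul (contDiffOn_pd hψ hU k)

theorem differentiableAt_of_contDiffOn {W : Type*} [NormedAddCommGroup W] [NormedSpace ℝ W]
    {f : Euc m → W} (hU : IsOpen U) (hf : ContDiffOn ℝ ∞ f U) {u : Euc m} (hu : u ∈ U) :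
    DifferentiableAt ℝ f u :=
  (hf.contDiffAt (hU.mem_nhds hu)).differentiableAt (by simp)

theorem pd_congr_of_isOpen {W : Type*} [NormedAddCommGroup W] [NormedSpace ℝ W]
    {f g : Euc m → W} (hU : IsOpen U) (h : ∀ u ∈ U, f u = g u) {u : Euc m} (hu : u ∈ U)
    (i : Fin m) : pd i f u = pd i g u :=
  pd_congr (Filter.eventually_of_mem (hU.mem_nhds hu) h) i

theorem pd_eq_fderiv_pd (hY : IsSphereParam Y) (hU : IsOpen U) (hψ : ContDiffOn ℝ ∞ ψ U)
    (hΦ : ∀ u ∈ U, Φ u = Y (ψ u)) {u : Euc m} (hu : u ∈ U) (i : Fin m) :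
    pd i Φ u = fderiv ℝ Y (ψ u) (pd i ψ u) := by
  rw [pd_congr_of_isOpen hU hΦ hu]
  exact pd_comp (hY.differentiableAt _) (differentiableAt_of_contDiffOn hU hψ hu) i

/-- The Christoffel term of the pull-back connection is the tangential part of the second derivative
of `Y`. By the Gauss formula what remains is the normal part, the multiple of `Φ` added back here.
-/
theorem fderiv_pullbackCov (hY : IsSphereParam Y) (hU : IsOpen U) (hψ : ContDiffOn ℝ ∞ ψ U)
    (hΦ : ∀ u ∈ U, Φ u = Y (ψ u)) (hV : ContDiffOn ℝ ∞ V U)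
    (hT : ∀ u ∈ U, T u = fderiv ℝ Y (ψ u) (V u)) {u : Euc m} (hu : u ∈ U) (i : Fin m) :
    fderiv ℝ Y (ψ u) (pullbackCov (gram Y) ψ i V u) =
      pd i T u + inner ℝ (pd i Φ u) (T u) • Φ u := by
  rw [pd_congr_of_isOpen hU hT hu, pd_fderiv_comp hY.contDiff.contDiffAt
    (differentiableAt_of_contDiffOn hU hψ hu) (differentiableAt_of_contDiffOn hU hV hu),
    hY.gauss_apply, pd_eq_fderiv_pd hY hU hψ hΦ hu, hT u hu, hΦ u hu, pullbackCov, map_add]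
  module

theorem fderiv_tension (hY : IsSphereParam Y) (hU : IsOpen U)
    (hψ : ContDiffOn ℝ ∞ ψ U) (hΦ : ∀ u ∈ U, Φ u = Y (ψ u)) {u : Euc m} (hu : u ∈ U) :
    fderiv ℝ Y (ψ u) (tension (gram X) (gram Y) ψ u) =
      laplaceBeltrami (gram X) Φ u + energy (gram X) Φ u • Φ u := by
  have h : ∀ i j, fderiv ℝ Y (ψ u) (pullbackCov (gram Y) ψ i (pd j ψ) u) =
      pd i (pd j Φ) u + inner ℝ (pd i Φ u) (pd j Φ u) • Φ u := fun i j =>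
    fderiv_pullbackCov hY hU hψ hΦ (contDiffOn_pd hψ hU j)
      (fun v hv => pd_eq_fderiv_pd hY hU hψ hΦ hv j) hu i
  simp only [tension, laplaceBeltrami, energy, map_sum, map_smul, map_sub, h,
    ← pd_eq_fderiv_pd hY hU hψ hΦ hu, Finset.sum_smul, ← Finset.sum_add_distrib]
  refine Finset.sum_congr rfl fun i _ => Finset.sum_congr rfl fun j _ => ?_
  module

theorem contDiffOn_of_fderiv (hY : IsSphereParam Y) (hψ : ContDiffOn ℝ ∞ ψ U)
    (hV : ContDiffOn ℝ ∞ V U) (hT : ∀ u ∈ U, T u = fderiv ℝ Y (ψ u) (V u)) :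
    ContDiffOn ℝ ∞ T U :=
  (((hY.contDiff.fderiv_right (m := ∞) (by simp)).comp_contDiffOn hψ).clm_apply hV).congr hT

/-- Apply `fderiv_pullbackCov` twice. Differentiating the correction along `Φ` from the first
application gives the tangential term with `∂_i Φ`; everything along `Φ` is left in the unspecified
`s`. -/
theorem fderiv_roughLaplacian (hY : IsSphereParam Y) (hU : IsOpen U)
    (hψ : ContDiffOn ℝ ∞ ψ U) (hΦ : ∀ u ∈ U, Φ u = Y (ψ u)) (hV : ContDiffOn ℝ ∞ V U)
    (hT : ∀ u ∈ U, T u = fderiv ℝ Y (ψ u) (V u)) {u : Euc m} (hu : u ∈ U) :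
    ∃ s : ℝ, fderiv ℝ Y (ψ u) (roughLaplacian (gram X) (gram Y) ψ V u) =
      -(laplaceBeltrami (gram X) T u
        + ∑ i, ∑ j, (gram X u)⁻¹ i j • inner ℝ (T u) (pd j Φ u) • pd i Φ u) + s • Φ u := by
  have hTs := contDiffOn_of_fderiv hY hψ hV hT
  have hΦs : ContDiffOn ℝ ∞ Φ U := (hY.contDiff.comp_contDiffOn hψ).congr hΦ
  have h1 : ∀ j, ∀ v ∈ U, pd j T v + inner ℝ (pd j Φ v) (T v) • Φ v =
      fderiv ℝ Y (ψ v) (pullbackCov (gram Y) ψ j V v) := fun j v hv =>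
    (fderiv_pullbackCov hY hU hψ hΦ hV hT hv j).symm
  have hq : ∀ j, DifferentiableAt ℝ (fun v => inner ℝ (pd j Φ v) (T v)) u := fun j =>
    differentiableAt_of_contDiffOn hU ((contDiffOn_pd hΦs hU j).inner ℝ hTs) hu
  have hΦd := differentiableAt_of_contDiffOn hU hΦs hu
  have h2 : ∀ i j, ∃ s : ℝ,
      fderiv ℝ Y (ψ u) (pullbackCov (gram Y) ψ i (pullbackCov (gram Y) ψ j V) u) =
      pd i (pd j T) u + inner ℝ (T u) (pd j Φ u) • pd i Φ u + s • Φ u := by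
    intro i j
    have h := fderiv_pullbackCov hY hU hψ hΦ (contDiffOn_pullbackCov hY hU hψ hV j) (h1 j) hu i
    rw [pd_add (differentiableAt_of_contDiffOn hU (contDiffOn_pd hTs hU j) hu)
      ((hq j).fun_smul hΦd), pd_smul (hq j) hΦd, real_inner_comm (T u)] at h
    exact ⟨_, h.trans (by rw [← add_assoc, add_assoc _ (_ • Φ u), ← add_smul])⟩
  choose s hs using h2
  -- Both the iterated derivatives and the terms subtracted for the domain connection have
  -- components along `Φ`.
  refine ⟨-∑ i, ∑ j, (gram X u)⁻¹ i j * (s i j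
    - ∑ k, christoffel (gram X) k i j u * inner ℝ (pd k Φ u) (T u)), ?_⟩
  simp only [roughLaplacian, laplaceBeltrami, map_neg, map_sum, map_smul, map_sub, hs,
    ← h1 _ u hu, neg_smul, ← neg_add, neg_inj, Finset.sum_smul, ← Finset.sum_add_distrib]
  refine Finset.sum_congr rfl fun i _ => Finset.sum_congr rfl fun j _ => ?_
  simp only [smul_add, Finset.sum_add_distrib, mul_sub, sub_smul, smul_sub, Finset.smul_sum,
    smul_smul, Finset.mul_sum, Finset.sum_smul]
  module

/-- The curvature trace is the trace of ⟨T, dΦ⟩ dΦ minus |dΦ|² T. Its first part cancels the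
tangential term of the rough Laplacian, its second part survives. -/
theorem fderiv_bitension (hX : IsSphereParam X) (hY : IsSphereParam Y) (hU : IsOpen U)
    (hψ : ContDiffOn ℝ ∞ ψ U) (hΦ : ∀ u ∈ U, Φ u = Y (ψ u))
    (hT : ∀ u ∈ U, T u = laplaceBeltrami (gram X) Φ u + energy (gram X) Φ u • Φ u)
    {u : Euc m} (hu : u ∈ U) :
    ∃ s : ℝ, fderiv ℝ Y (ψ u) (bitension (gram X) (gram Y) ψ u) =
      laplaceBeltrami (gram X) T u + energy (gram X) Φ u • T u + s • Φ u := by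
  have hT' : ∀ u ∈ U, T u = fderiv ℝ Y (ψ u) (tension (gram X) (gram Y) ψ u) := fun v hv =>
    (hT v hv).trans (fderiv_tension hY hU hψ hΦ hv).symm
  obtain ⟨s, hs⟩ := fderiv_roughLaplacian (X := X) hY hU hψ hΦ (contDiffOn_tension hX hY hU hψ) hT' hu
  refine ⟨-s, ?_⟩
  simp only [bitension, map_sub, map_neg, hs, map_sum, map_smul, hY.fderiv_curvature,
    ← pd_eq_fderiv_pd hY hU hψ hΦ hu, ← hT' u hu, smul_sub, Finset.sum_sub_distrib, energy,
    Finset.sum_smul, smul_smul]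
  module

end

/-! ### The Laplacian and the energy density of the sphere for ambient functions. -/

/-- The Laplace-Beltrami operator of the unit sphere of `ℝ^{m+1}`, in terms of an extension of the
function to the ambient space. -/
noncomputable def sphereLaplacian {m : ℕ} {W : Type*} [NormedAddCommGroup W] [NormedSpace ℝ W]
    (f : Euc (m + 1) → W) (x : Euc (m + 1)) : W :=
  ∑ i, pd i (pd i f) x - fderiv ℝ (fderiv ℝ f) x x x - (m : ℝ) • fderiv ℝ f x x

namespace IsSphereParam

variable {m : ℕ} {X : Euc m → Euc (m + 1)} {W : Type*} [NormedAddCommGroup W] [NormedSpace ℝ W]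

/-- The tangential trace is the full Euclidean trace minus the contribution of the unit normal `X
u`. -/
theorem sum_bilin (hX : IsSphereParam X) (u : Euc m)
    (B : Euc (m + 1) →L[ℝ] Euc (m + 1) →L[ℝ] W) :
    ∑ i, ∑ j, (gram X u)⁻¹ i j • B (pd i X u) (pd j X u) =
      ∑ α, B (EuclideanSpace.single α 1) (EuclideanSpace.single α 1) - B (X u) (X u) := by
  have h : ∀ α, B (EuclideanSpace.single α 1) (EuclideanSpace.single α 1) =
      ∑ i, ∑ j, ((gram X u)⁻¹ i j * pd j X u α) • B (pd i X u) (EuclideanSpace.single α 1)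
        + X u α • B (X u) (EuclideanSpace.single α 1) := by
    intro α
    -- Only the first argument is resolved; summation over `α` then reassembles the second argument
    -- from its coordinates.
    conv_lhs => enter [1]; rw [hX.resolution u (EuclideanSpace.single α (1 : ℝ))]
    simp [EuclideanSpace.inner_single_right, Finset.sum_smul]
  have h2 : ∀ (L : Euc (m + 1) →L[ℝ] W) (v : Euc (m + 1)),
      L v = ∑ α, v α • L (EuclideanSpace.single α 1) := by
    intro L v
    conv_lhs => rw [← (EuclideanSpace.basisFun (Fin (m + 1)) ℝ).sum_repr v]
    simp
  simp only [h, Finset.sum_add_distrib, ← h2, add_sub_cancel_right]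
  conv_rhs => rw [Finset.sum_comm]
  refine Finset.sum_congr rfl fun i _ => ?_
  conv_rhs => rw [Finset.sum_comm]
  refine Finset.sum_congr rfl fun j _ => ?_
  rw [h2 (B (pd i X u)) (pd j X u), Finset.smul_sum]
  simp only [smul_smul]

theorem sum_gram_inv_mul_gram (hX : IsSphereParam X) (u : Euc m) :
    ∑ i, ∑ j, (gram X u)⁻¹ i j * gram X u i j = (m : ℝ) := by
  have h : ∀ i, ∑ j, (gram X u)⁻¹ i j * gram X u i j = 1 := by
    intro i
    rw [← (hX.sum_gram_mul_inv u i i).trans (if_pos rfl)]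
    exact Finset.sum_congr rfl fun j _ => by rw [gram_inv_symm, mul_comm]
  simp [h]

/-- In the chain rule the Gauss formula cancels the Christoffel terms and leaves `-g_{ij} df(X)`,
whose trace has the factor `m`. -/
theorem laplaceBeltrami_comp (hX : IsSphereParam X) {f : Euc (m + 1) → W} (hf : ContDiff ℝ ∞ f)
    (u : Euc m) : laplaceBeltrami (gram X) (fun v => f (X v)) u = sphereLaplacian f (X u) := by
  have h1 : ∀ i j, pd i (pd j fun v => f (X v)) u
      - ∑ k, christoffel (gram X) k i j u • pd k (fun v => f (X v)) u =
      fderiv ℝ (fderiv ℝ f) (X u) (pd i X u) (pd j X u) - gram X u i j • fderiv ℝ f (X u) (X u) := by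
    intro i j
    rw [pd_pd_comp hf hX.contDiff, hX.gauss]
    simp only [pd_comp (hf.differentiable (by simp) _) (hX.differentiableAt u), map_sub, map_sum,
      map_smul]
    module
  simp only [laplaceBeltrami, h1, smul_sub, Finset.sum_sub_distrib, hX.sum_bilin, smul_smul,
    ← Finset.sum_smul, hX.sum_gram_inv_mul_gram, sphereLaplacian,
    fderiv_fderiv_single hf.contDiffAt]

theorem energy_comp (hX : IsSphereParam X) {N : ℕ} {f : Euc (m + 1) → Euc N}
    (hf : ContDiff ℝ ∞ f) (u : Euc m) :
    energy (gram X) (fun v => f (X v)) u = normSqD f (X u) - ‖fderiv ℝ f (X u) (X u)‖ ^ 2 := by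
  have h := hX.sum_bilin u ((innerSL ℝ : Euc N →L[ℝ] Euc N →L[ℝ] ℝ).bilinearComp
    (fderiv ℝ f (X u)) (fderiv ℝ f (X u)))
  simp only [ContinuousLinearMap.bilinearComp_apply, innerSL_apply_apply, smul_eq_mul,
    real_inner_self_eq_norm_sq] at h
  simp only [energy, pd_comp (hf.differentiable (by simp) _) (hX.differentiableAt u), h]
  rfl

end IsSphereParam

/-! ### Stereographic charts as sphere parametrisations. -/

/-- The inverse of the chart around `p`, as a map into the ambient space. -/
noncomputable def sphereParam {m : ℕ} (p : Sph m) (u : Euc m) : Euc (m + 1) :=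
  ((chartAt (Euc m) p).symm u : Sph m)

section

variable {m : ℕ} (p : Sph m)

/-- The chart is stereographic projection from `-p`, so its inverse is defined everywhere; this is
why `IsSphereParam` can ask for a global map. -/
theorem chartAt_sphere_target : (chartAt (Euc m) p).target = Set.univ :=
  have : Fact (Module.finrank ℝ (Euc (m + 1)) = m + 1) := ⟨finrank_euclideanSpace_fin⟩
  stereographic'_target (-p)

theorem contMDiff_sphere_val : ContMDiff (𝓡 m) 𝓘(ℝ, Euc (m + 1)) ∞
    (Subtype.val : Sph m → Euc (m + 1)) :=
  have : Fact (Module.finrank ℝ (Euc (m + 1)) = m + 1) := ⟨finrank_euclideanSpace_fin⟩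
  contMDiff_coe_sphere

theorem contMDiff_chartAt_symm :
    ContMDiff (𝓡 m) (𝓡 m) ∞ ((chartAt (Euc m) p).symm : Euc m → Sph m) := by
  have h := contMDiffOn_chart_symm (I := 𝓡 m) (n := ∞) (x := p)
  rwa [chartAt_sphere_target, contMDiffOn_univ] at h

theorem fderiv_sphereParam (u v : Euc m) :
    fderiv ℝ (sphereParam p) u v = dIncl ((chartAt (Euc m) p).symm u)
      (mfderiv (𝓡 m) (𝓡 m) (chartAt (Euc m) p).symm u v) := by
  have h := mfderiv_comp (I := 𝓡 m) (I' := 𝓡 m) (I'' := 𝓘(ℝ, Euc (m + 1))) u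
    ((contMDiff_sphere_val.mdifferentiable (by simp)) ((chartAt (Euc m) p).symm u))
    ((contMDiff_chartAt_symm p).mdifferentiable (by simp) u)
  rw [← mfderiv_eq_fderiv]
  exact congrArg (fun L => L v) h

theorem isSphereParam_sphereParam : IsSphereParam (sphereParam p) where
  contDiff := (contMDiff_sphere_val.comp (contMDiff_chartAt_symm p)).contDiff
  norm_eq u := mem_sphere_zero_iff_norm.1 ((chartAt (Euc m) p).symm u).2
  injective u := by
    have h := (mdifferentiable_chart (I := 𝓡 m) p).symm.mfderiv_injective (x := u)
      (by simp [chartAt_sphere_target])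
    have h2 : ⇑(fderiv ℝ (sphereParam p) u) = dIncl ((chartAt (Euc m) p).symm u) ∘
        mfderiv (𝓡 m) (𝓡 m) (chartAt (Euc m) p).symm u := funext (fderiv_sphereParam p u)
    rw [h2]
    exact (dIncl_injective _).comp h

theorem metricCoeff_roundMetric : metricCoeff (roundMetric m) p = gram (sphereParam p) := by
  funext u
  ext i j
  simp only [metricCoeff, gram, Matrix.of_apply, pd, fderiv_sphereParam]
  rfl

theorem sphereParam_chartAt {p q : Sph m} (hq : q ∈ (chartAt (Euc m) p).source) :
    sphereParam p (chartAt (Euc m) p q) = q :=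
  congrArg Subtype.val ((chartAt (Euc m) p).left_inv hq)

theorem dIncl_eq_fderiv (v : TangentSpace (𝓡 m) p) :
    dIncl p v = fderiv ℝ (sphereParam p) (chartAt (Euc m) p p) v := by
  have h := (contMDiff_sphere_val (m := m)).mdifferentiable (by simp) p
  rw [dIncl, h.mvfderiv]
  simp only [fderivWithin_univ, mfld_simps]
  rfl

theorem exists_isSphereParam {x : Euc (m + 1)} (hx : ‖x‖ = 1) :
    ∃ X : Euc m → Euc (m + 1), IsSphereParam X ∧ ∃ u, X u = x :=
  let p : Sph m := ⟨x, mem_sphere_zero_iff_norm.2 hx⟩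
  ⟨_, isSphereParam_sphereParam p, _, sphereParam_chartAt (mem_chart_source (Euc m) p)⟩

end

/-- The bitension field of a map between unit spheres, up to its component normal to the target
sphere, for a map that extends to a smooth map of the ambient spaces. -/
theorem dIncl_bitensionField {m n : ℕ} {φ : Sph m → Sph n} {F T : Euc (m + 1) → Euc (n + 1)}
    (hF : ContDiff ℝ ∞ F) (hφ : ∀ q, (φ q : Euc (n + 1)) = F q) (hT : ContDiff ℝ ∞ T)
    (h : ∀ x, ‖x‖ = 1 → T x = sphereLaplacian F x
      + (normSqD F x - ‖fderiv ℝ F x x‖ ^ 2) • F x) (p : Sph m) :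
    inner ℝ (F p) (dIncl (φ p) (bitensionField (roundMetric m) (roundMetric n) φ p)) = (0 : ℝ) ∧
    ∃ s : ℝ, dIncl (φ p) (bitensionField (roundMetric m) (roundMetric n) φ p) =
      sphereLaplacian T p + (normSqD F p - ‖fderiv ℝ F p p‖ ^ 2) • T p + s • F p := by
  set X := sphereParam p with hXdef
  set Y := sphereParam (φ p) with hYdef
  have hX : IsSphereParam X := isSphereParam_sphereParam p
  have hY : IsSphereParam Y := isSphereParam_sphereParam (φ p)
  set u₀ := chartAt (Euc m) p p with hu₀
  set ψ : Euc m → Euc n := chartAt (Euc n) (φ p) ∘ φ ∘ (chartAt (Euc m) p).symm with hψdef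
  -- Smoothness of `φ` is inherited from `F` by restricting domain and codomain to the spheres.
  have hφs : ContMDiff (𝓡 m) (𝓡 n) ∞ φ := by
    have : Fact (Module.finrank ℝ (Euc (n + 1)) = n + 1) := ⟨finrank_euclideanSpace_fin⟩
    have hF' : ContMDiff (𝓡 m) 𝓘(ℝ, Euc (n + 1)) ∞ (fun q : Sph m => F q) :=
      hF.contMDiff.comp contMDiff_sphere_val
    have hmem : ∀ q : Sph m, F q ∈ Metric.sphere (0 : Euc (n + 1)) 1 := fun q => by
      rw [← hφ]; exact (φ q).2
    have hφ' : φ = Set.codRestrict (fun q : Sph m => F q) _ hmem :=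
      funext fun q => Subtype.ext (hφ q)
    rw [hφ']
    exact ContMDiff.codRestrict_sphere (n := n) hF' hmem
  -- The image of `φ` may leave the chart around `φ p`, so the coordinate expression `ψ` is
  -- controlled only on `U`.
  set U : Set (Euc m) := (φ ∘ (chartAt (Euc m) p).symm) ⁻¹' (chartAt (Euc n) (φ p)).source with hU'
  have hcs : ContMDiff (𝓡 m) (𝓡 n) ∞ (φ ∘ (chartAt (Euc m) p).symm) :=
    hφs.comp (contMDiff_chartAt_symm p)
  have hU : IsOpen U := (chartAt (Euc n) (φ p)).open_source.preimage hcs.continuous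
  have hinv : (chartAt (Euc m) p).symm u₀ = p :=
    (chartAt (Euc m) p).left_inv (mem_chart_source _ p)
  have hu : u₀ ∈ U := by
    simp only [hU', Set.mem_preimage, Function.comp_apply, hinv]
    exact mem_chart_source _ _
  have hψ : ContDiffOn ℝ ∞ ψ U := by
    rw [← contMDiffOn_iff_contDiffOn]
    exact (contMDiffOn_chart (I := 𝓡 n) (x := φ p)).comp hcs.contMDiffOn (fun _ h => h)
  have hΦ : ∀ u ∈ U, F (X u) = Y (ψ u) := fun u hu => by
    rw [hYdef, hψdef, Function.comp_apply, sphereParam_chartAt hu, Function.comp_apply, hφ]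
    rfl
  have hX0 : X u₀ = p := sphereParam_chartAt (mem_chart_source _ p)
  have hTu : ∀ u ∈ U, T (X u) = laplaceBeltrami (gram X) (fun v => F (X v)) u
      + energy (gram X) (fun v => F (X v)) u • F (X u) := fun u _ => by
    rw [hX.laplaceBeltrami_comp hF, hX.energy_comp hF]
    exact h _ (hX.norm_eq u)
  have hd : dIncl (φ p) (bitensionField (roundMetric m) (roundMetric n) φ p) =
      fderiv ℝ Y (ψ u₀) (bitension (gram X) (gram Y) ψ u₀) := by
    rw [dIncl_eq_fderiv, bitensionField, metricCoeff_roundMetric, metricCoeff_roundMetric]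
    simp only [hψdef, Function.comp_apply, hinv]
    rfl
  rw [hd]
  constructor
  · rw [← hX0, hΦ u₀ hu]
    exact hY.inner_fderiv _ _
  · obtain ⟨s, hs⟩ := fderiv_bitension (Φ := fun u => F (X u)) (T := fun u => T (X u)) hX hY hU hψ
      hΦ hTu hu
    refine ⟨s, ?_⟩
    rw [hs, hX.laplaceBeltrami_comp hT, hX.energy_comp hF, hX0]

/-! ### The Euclidean Laplacian and the Bochner formula. -/

section Laplacian

variable {m : ℕ} {W : Type*} [NormedAddCommGroup W] [NormedSpace ℝ W]

theorem differentiableAt_pd {f : Euc m → W} (hf : ContDiff ℝ ∞ f) (i : Fin m) (x : Euc m) :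
    DifferentiableAt ℝ (pd i f) x :=
  (contDiff_pd hf i).differentiable (by simp) x

theorem lap_apply {f : Euc m → W} (hf : ContDiff ℝ ∞ f) (x : Euc m) :
    lap f x = -∑ i, pd i (pd i f) x := by
  simp only [lap, Pi.neg_apply, InnerProductSpace.laplacian_eq_iteratedFDeriv_orthonormalBasis f
    (EuclideanSpace.basisFun (Fin m) ℝ), iteratedFDeriv_two_apply,
    fderiv_fderiv_single hf.contDiffAt]
  simp

theorem contDiff_lap {f : Euc m → W} (hf : ContDiff ℝ ∞ f) : ContDiff ℝ ∞ (lap f) := by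
  rw [funext (lap_apply hf)]
  exact (ContDiff.sum fun i _ => contDiff_pd (contDiff_pd hf i) i).neg

theorem pd_neg (f : Euc m → W) (x : Euc m) (i : Fin m) :
    pd i (fun y => -f y) x = -pd i f x := by
  simp [pd, fderiv_fun_neg]

theorem pd_lap {f : Euc m → W} (hf : ContDiff ℝ ∞ f) (x : Euc m) (i : Fin m) :
    pd i (lap f) x = lap (pd i f) x := by
  rw [funext (lap_apply hf), lap_apply (contDiff_pd hf i), pd_neg,
    pd_sum fun j _ => differentiableAt_pd (contDiff_pd hf j) j x]
  congr 1
  refine Finset.sum_congr rfl fun j _ => ?_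
  rw [pd_comm (contDiff_pd hf j).contDiffAt]
  exact congrArg (fun g => pd j g x) (funext fun y => pd_comm hf.contDiffAt i j)

theorem lap_sub {f g : Euc m → W} (hf : ContDiff ℝ ∞ f) (hg : ContDiff ℝ ∞ g) (x : Euc m) :
    lap (fun y => f y - g y) x = lap f x - lap g x := by
  rw [lap_apply (hf.sub hg), lap_apply hf, lap_apply hg]
  have h : ∀ i, pd i (pd i fun y => f y - g y) x = pd i (pd i f) x - pd i (pd i g) x := by
    intro i
    rw [← pd_sub (differentiableAt_pd hf i x) (differentiableAt_pd hg i x)]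
    exact congrArg (fun g => pd i g x) (funext fun y =>
      pd_sub (hf.differentiable (by simp) y) (hg.differentiable (by simp) y) i)
  simp only [h, Finset.sum_sub_distrib]
  abel

theorem lap_const_smul {f : Euc m → W} (hf : ContDiff ℝ ∞ f) (c : ℝ) (x : Euc m) :
    lap (fun y => c • f y) x = c • lap f x := by
  rw [lap_apply (hf.const_smul c), lap_apply hf]
  have h : ∀ i, pd i (pd i fun y => c • f y) x = c • pd i (pd i f) x := by
    intro i
    rw [← pd_const_smul c (differentiableAt_pd hf i x)]
    exact congrArg (fun g => pd i g x) (funext fun y =>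
      pd_const_smul c (hf.differentiable (by simp) y) i)
  simp only [h, smul_neg, Finset.smul_sum]

theorem lap_sum {ι : Type*} [Fintype ι] {f : ι → Euc m → W} (hf : ∀ a, ContDiff ℝ ∞ (f a))
    (x : Euc m) : lap (fun y => ∑ a, f a y) x = ∑ a, lap (f a) x := by
  rw [lap_apply (ContDiff.sum fun a _ => hf a)]
  have h : ∀ i, pd i (pd i fun y => ∑ a, f a y) x = ∑ a, pd i (pd i (f a)) x := by
    intro i
    rw [← pd_sum fun a _ => differentiableAt_pd (hf a) i x]
    exact congrArg (fun g => pd i g x) (funext fun y =>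
      pd_sum (fun a _ => (hf a).differentiable (by simp) y) i)
  simp only [h, lap_apply (hf _), Finset.sum_neg_distrib]
  rw [Finset.sum_comm]

theorem lap_inner {V : Type*} [NormedAddCommGroup V] [InnerProductSpace ℝ V] {f g : Euc m → V}
    (hf : ContDiff ℝ ∞ f) (hg : ContDiff ℝ ∞ g) (x : Euc m) :
    lap (fun y => inner ℝ (f y) (g y)) x = inner ℝ (f x) (lap g x) + inner ℝ (lap f x) (g x)
      - 2 * ∑ i, inner ℝ (pd i f x) (pd i g x) := by
  rw [lap_apply (hf.inner ℝ hg), lap_apply hf, lap_apply hg]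
  have hfd : ∀ y, DifferentiableAt ℝ f y := hf.differentiable (by simp)
  have hgd : ∀ y, DifferentiableAt ℝ g y := hg.differentiable (by simp)
  have h : ∀ i, pd i (pd i fun y => inner ℝ (f y) (g y)) x =
      inner ℝ (f x) (pd i (pd i g) x) + inner ℝ (pd i (pd i f) x) (g x)
        + 2 * inner ℝ (pd i f x) (pd i g x) := by
    intro i
    rw [show pd i (fun y => inner ℝ (f y) (g y)) = fun y =>
        inner ℝ (f y) (pd i g y) + inner ℝ (pd i f y) (g y) from
        funext fun y => pd_inner (hfd y) (hgd y) i,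
      pd_add ((hfd x).inner ℝ (differentiableAt_pd hg i x))
        ((differentiableAt_pd hf i x).inner ℝ (hgd x)),
      pd_inner (hfd x) (differentiableAt_pd hg i x), pd_inner (differentiableAt_pd hf i x) (hgd x)]
    ring
  simp only [h, Finset.sum_add_distrib, inner_neg_left, inner_neg_right, inner_sum, sum_inner,
    ← Finset.mul_sum]
  ring

theorem contDiff_normSqD {V : Type*} [NormedAddCommGroup V] [InnerProductSpace ℝ V] {f : Euc m → V}
    (hf : ContDiff ℝ ∞ f) : ContDiff ℝ ∞ (normSqD f) :=
  ContDiff.sum fun i _ => (contDiff_pd hf i).norm_sq ℝ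

theorem normSqD_eq {V : Type*} [NormedAddCommGroup V] [InnerProductSpace ℝ V] (f : Euc m → V) :
    normSqD f = fun x => ∑ i, inner ℝ (pd i f x) (pd i f x) := by
  funext x
  simp only [normSqD, real_inner_self_eq_norm_sq]

/-- A Bochner formula for `|df|²`. -/
theorem lap_normSqD {V : Type*} [NormedAddCommGroup V] [InnerProductSpace ℝ V] {f : Euc m → V}
    (hf : ContDiff ℝ ∞ f) (x : Euc m) :
    lap (normSqD f) x = 2 * ∑ i, inner ℝ (pd i f x) (pd i (lap f) x) - 2 * normSqHess f x := by
  have h : ∀ i, lap (fun y => inner ℝ (pd i f y) (pd i f y)) x =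
      2 * inner ℝ (pd i f x) (pd i (lap f) x) - 2 * ∑ j, ‖pd j (pd i f) x‖ ^ 2 := by
    intro i
    rw [lap_inner (contDiff_pd hf i) (contDiff_pd hf i), pd_lap hf,
      real_inner_comm (pd i f x) (lap (pd i f) x)]
    simp only [real_inner_self_eq_norm_sq]
    ring
  rw [normSqD_eq, lap_sum fun i => (contDiff_pd hf i).inner ℝ (contDiff_pd hf i), normSqHess,
    Finset.sum_comm]
  simp only [h, Finset.sum_sub_distrib, ← Finset.mul_sum]

theorem fderiv_gradient {V : Type*} [NormedAddCommGroup V] [NormedSpace ℝ V] (f : Euc m → V)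
    (q : Euc m → ℝ) (x : Euc m) :
    fderiv ℝ f x (gradient q x) = ∑ i, pd i q x • pd i f x := by
  rw [fderiv_eq_sum_pd]
  refine Finset.sum_congr rfl fun i _ => ?_
  congr 1
  have h : inner ℝ (gradient q x) (EuclideanSpace.single i (1 : ℝ)) = pd i q x := by
    simp [gradient, pd]
  rw [← h, EuclideanSpace.inner_single_right]
  simp

end Laplacian

/-! ### Homogeneous functions and Euler's equation. -/

section Euler

/-- Euler's equation `df(x) x = a f(x)` of the functions that are homogeneous of degree `a`. -/
def IsEuler {m : ℕ} {W : Type*} [NormedAddCommGroup W] [NormedSpace ℝ W] (a : ℝ) (f : Euc m → W) :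
    Prop :=
  ∀ x, fderiv ℝ f x x = a • f x

variable {m : ℕ} {W : Type*} [NormedAddCommGroup W] [NormedSpace ℝ W] {a b : ℝ}

/-- Differentiate Euler's equation in the direction `v`. -/
theorem IsEuler.fderiv_fderiv {f : Euc m → W} (h : IsEuler a f) (hf : ContDiff ℝ ∞ f)
    (x v : Euc m) : fderiv ℝ (fderiv ℝ f) x v x = (a - 1) • fderiv ℝ f x v := by
  have hf' : DifferentiableAt ℝ (fderiv ℝ f) x :=
    (hf.fderiv_right (m := ∞) (by simp)).differentiable (by simp) x
  have h1 := (hf'.hasFDerivAt.clm_apply (hasFDerivAt_id x)).fderiv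
  have h2 : (fun y => fderiv ℝ f y (id y)) = fun y => a • f y := funext h
  rw [h2, fderiv_fun_const_smul (hf.differentiable (by simp) x)] at h1
  have h3 := congrArg (fun L => L v) h1
  simp at h3
  rw [sub_smul, one_smul, h3]
  abel

/-- The degree is a real number, so forms of degree zero or one need no separate treatment when
derivatives lower it. -/
theorem isEuler_pd {f : Euc m → W} (h : IsEuler a f) (hf : ContDiff ℝ ∞ f) (i : Fin m) :
    IsEuler (a - 1) (pd i f) := by
  intro x
  rw [fderiv_eq_sum_pd]
  simp only [fderiv_fderiv_single hf.contDiffAt]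
  rw [pd, ← h.fderiv_fderiv hf, fderiv_fderiv_symm hf.contDiffAt,
    fderiv_eq_sum_pd (fderiv ℝ f) x x, sum_apply]
  rfl

theorem IsEuler.neg {f : Euc m → W} (h : IsEuler a f) : IsEuler a fun x => -f x := by
  intro x
  rw [fderiv_fun_neg, neg_apply, h x, smul_neg]

theorem IsEuler.sum {ι : Type*} [Fintype ι] {f : ι → Euc m → W} (h : ∀ i, IsEuler a (f i))
    (hf : ∀ i, ContDiff ℝ ∞ (f i)) : IsEuler a fun x => ∑ i, f i x := by
  intro x
  rw [fderiv_fun_sum fun i _ => (hf i).differentiable (by simp) x, sum_apply, Finset.smul_sum]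
  exact Finset.sum_congr rfl fun i _ => h i x

theorem isEuler_inner {V : Type*} [NormedAddCommGroup V] [InnerProductSpace ℝ V] {f g : Euc m → V}
    (hf : IsEuler a f) (hg : IsEuler b g) (hf' : ContDiff ℝ ∞ f) (hg' : ContDiff ℝ ∞ g) :
    IsEuler (a + b) fun x => inner ℝ (f x) (g x) := by
  intro x
  rw [fderiv_inner_apply ℝ (hf'.differentiable (by simp) x) (hg'.differentiable (by simp) x), hf x,
    hg x, real_inner_smul_left, real_inner_smul_right, smul_eq_mul]
  ring

theorem isEuler_lap {f : Euc m → W} (h : IsEuler a f) (hf : ContDiff ℝ ∞ f) :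
    IsEuler (a - 2) (lap f) := by
  have h1 : ∀ i, IsEuler (a - 2) (pd i (pd i f)) := fun i => by
    have := isEuler_pd (isEuler_pd h hf i) (contDiff_pd hf i) i
    rwa [sub_sub, one_add_one_eq_two] at this
  have h2 := (IsEuler.sum h1 fun i => contDiff_pd (contDiff_pd hf i) i).neg
  rwa [← funext (lap_apply hf)] at h2

theorem isEuler_normSqD {V : Type*} [NormedAddCommGroup V] [InnerProductSpace ℝ V] {f : Euc m → V}
    (h : IsEuler a f) (hf : ContDiff ℝ ∞ f) : IsEuler (2 * (a - 1)) (normSqD f) := by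
  rw [normSqD_eq, two_mul]
  exact IsEuler.sum (fun i => isEuler_inner (isEuler_pd h hf i) (isEuler_pd h hf i)
    (contDiff_pd hf i) (contDiff_pd hf i))
    fun i => (contDiff_pd hf i).inner ℝ (contDiff_pd hf i)

theorem contDiff_eval_mvPolynomial {m : ℕ} (P : MvPolynomial (Fin m) ℝ) :
    ContDiff ℝ ∞ fun x : Euc m => MvPolynomial.eval (fun i => x i) P := by
  simp only [MvPolynomial.eval_eq']
  exact ContDiff.sum fun d _ => contDiff_const.mul (contDiff_prod fun i _ =>
    (((contDiff_euclidean (𝕜 := ℝ)).1 contDiff_id i).pow _))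

theorem eval_smul_mvPolynomial {m k : ℕ} {P : MvPolynomial (Fin m) ℝ} (hP : P.IsHomogeneous k)
    (t : ℝ) (x : Fin m → ℝ) :
    MvPolynomial.eval (fun i => t * x i) P = t ^ k * MvPolynomial.eval x P := by
  simp only [MvPolynomial.eval_eq', Finset.mul_sum, mul_pow, Finset.prod_mul_distrib,
    Finset.prod_pow_eq_pow_sum]
  refine Finset.sum_congr rfl fun d hd => ?_
  have h := hP (MvPolynomial.mem_support_iff.1 hd)
  rw [Finsupp.weight_apply, Finsupp.sum_fintype _ _ (by simp)] at h
  simp only [Pi.one_apply, smul_eq_mul, mul_one] at h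
  rw [h]
  ring

theorem IsForm.contDiff {m n k : ℕ} {F : Euc m → Euc n} (hF : IsForm k F) : ContDiff ℝ ∞ F := by
  obtain ⟨P, -, hP⟩ := hF
  rw [contDiff_euclidean]
  intro j
  simp only [hP]
  exact contDiff_eval_mvPolynomial (P j)

/-- Differentiate F(tx) = t^k F(x) at t = 1. -/
theorem IsForm.isEuler {m n k : ℕ} {F : Euc m → Euc n} (hF : IsForm k F) : IsEuler (k : ℝ) F := by
  intro x
  have hd : HasFDerivAt F (fderiv ℝ F x) ((1 : ℝ) • x) := by
    rw [one_smul]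
    exact (hF.contDiff.differentiable (by simp) x).hasFDerivAt
  have h1 : HasDerivAt (fun t : ℝ => F (t • x)) (fderiv ℝ F x x) 1 := by
    have := hd.comp_hasDerivAt (1 : ℝ) ((hasDerivAt_id (1 : ℝ)).smul_const x)
    rw [one_smul] at this
    exact this
  have h2 : (fun t : ℝ => F (t • x)) = fun t => t ^ k • F x := by
    obtain ⟨P, hhom, hP⟩ := hF
    funext t
    ext j
    rw [hP]
    simp only [PiLp.smul_apply, smul_eq_mul, hP]
    exact eval_smul_mvPolynomial (hhom j) t _
  have h3 : HasDerivAt (fun t : ℝ => t ^ k • F x) ((k : ℝ) • F x) 1 := by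
    simpa using (hasDerivAt_pow k (1 : ℝ)).smul_const (F x)
  rw [h2] at h1
  exact h1.unique h3

end Euler

/-! ### Homogeneous maps of constant norm on the sphere. -/

section Sphere

variable {m : ℕ}

/-- The radial terms contribute a(a-1) + ma = a(a+m-1). -/
theorem sphereLaplacian_of_isEuler {W : Type*} [NormedAddCommGroup W] [NormedSpace ℝ W] {a : ℝ}
    {f : Euc (m + 1) → W} (h : IsEuler a f) (hf : ContDiff ℝ ∞ f) (x : Euc (m + 1)) :
    sphereLaplacian f x = -lap f x - (a * (a + m - 1)) • f x := by
  rw [sphereLaplacian, lap_apply hf, h.fderiv_fderiv hf, h x, neg_neg]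
  module

/-- On the unit sphere, the Laplacian of a homogeneous function that is constant there. -/
theorem IsEuler.lap_of_const {f : Euc (m + 1) → ℝ} {a c : ℝ} (h : IsEuler a f)
    (hf : ContDiff ℝ ∞ f) (hc : ∀ x, ‖x‖ = 1 → f x = c) {x : Euc (m + 1)} (hx : ‖x‖ = 1) :
    lap f x = -(a * (a + m - 1) * c) := by
  obtain ⟨X, hX, u, rfl⟩ := exists_isSphereParam hx
  have h1 := hX.laplaceBeltrami_comp hf u
  -- The pull-back is constant, so its Laplace-Beltrami operator vanishes and only the radial
  -- correction is left.
  have h2 : (fun v => f (X v)) = fun _ => c := funext fun v => hc _ (hX.norm_eq v)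
  have h3 : ∀ i, pd i (fun _ : Euc m => c) = fun _ => 0 := fun i => by
    funext y
    simp [pd]
  have h4 : ∀ i, pd i (fun _ : Euc m => (0 : ℝ)) = fun _ => 0 := fun i => by
    funext y
    simp [pd]
  rw [h2, sphereLaplacian_of_isEuler h hf, hc _ hx] at h1
  simp only [laplaceBeltrami, h3, h4] at h1
  simp at h1
  linarith

section

variable {V : Type*} [NormedAddCommGroup V] [InnerProductSpace ℝ V] {f : Euc (m + 1) → V}
  {k r : ℝ} {x : Euc (m + 1)}

/-- Compute the Laplacian of |f|² twice: by the product rule, and from its being homogeneous of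
degree 2k and equal to r² on the sphere. -/
theorem inner_lap_of_norm_eq (hE : IsEuler k f) (hf : ContDiff ℝ ∞ f)
    (hr : ∀ x, ‖x‖ = 1 → ‖f x‖ = r) (hx : ‖x‖ = 1) :
    inner ℝ (f x) (lap f x) = normSqD f x - r ^ 2 * k * (2 * k + m - 1) := by
  have h := (isEuler_inner hE hE hf hf).lap_of_const (hf.inner ℝ hf) (c := r ^ 2)
    (fun y hy => by rw [real_inner_self_eq_norm_sq, hr y hy]) hx
  rw [lap_inner hf hf, real_inner_comm (f x) (lap f x)] at h
  simp only [real_inner_self_eq_norm_sq] at h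
  rw [normSqD]
  linarith

/-- The Laplacian of |f|² is again homogeneous, of degree 2k-2, and constant on the sphere, so
`IsEuler.lap_of_const` applies a second time. -/
theorem inner_lap_lap_of_norm_eq (hE : IsEuler k f) (hf : ContDiff ℝ ∞ f)
    (hr : ∀ x, ‖x‖ = 1 → ‖f x‖ = r) (hx : ‖x‖ = 1) :
    inner ℝ (f x) (lap (lap f) x) =
      2 * r ^ 2 * k * (2 * k + m - 1) * (k - 1) * (2 * k + m - 3)
        - ‖lap f x‖ ^ 2 + 2 * lap (normSqD f) x + 2 * normSqHess f x := by
  have hN : ContDiff ℝ ∞ fun y => inner ℝ (f y) (f y) := hf.inner ℝ hf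
  have hNE := isEuler_inner hE hE hf hf
  have h1 := fun y (hy : ‖y‖ = 1) => hNE.lap_of_const hN (c := r ^ 2)
    (fun y hy => by rw [real_inner_self_eq_norm_sq, hr y hy]) hy
  have h2 := (isEuler_lap hNE hN).lap_of_const (contDiff_lap hN) h1 hx
  have h3 : lap (fun y => inner ℝ (f y) (f y)) =
      fun y => (2 : ℝ) • inner ℝ (f y) (lap f y) - (2 : ℝ) • normSqD f y := by
    funext y
    rw [lap_inner hf hf, real_inner_comm (f y) (lap f y), normSqD_eq, smul_eq_mul, smul_eq_mul]
    ring
  have hi : ContDiff ℝ ∞ fun y => inner ℝ (f y) (lap f y) := hf.inner ℝ (contDiff_lap hf)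
  rw [h3, lap_sub (hi.const_smul _) ((contDiff_normSqD hf).const_smul _), lap_const_smul hi,
    lap_const_smul (contDiff_normSqD hf), lap_inner hf (contDiff_lap hf),
    real_inner_self_eq_norm_sq, smul_eq_mul, smul_eq_mul] at h2
  -- The Bochner formula eliminates the sum of the products ⟨∂_i f, ∂_i Δf⟩.
  have h4 := lap_normSqD hf x
  linear_combination h2 / 2 - h4

/-- Tangential derivatives of `f` are orthogonal to `f` because its norm is constant on the sphere;
the radial derivative is given by Euler's equation. -/
theorem inner_fderiv_of_norm_eq (hE : IsEuler k f) (hf : ContDiff ℝ ∞ f)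
    (hr : ∀ x, ‖x‖ = 1 → ‖f x‖ = r) (hx : ‖x‖ = 1) (v : Euc (m + 1)) :
    inner ℝ (f x) (fderiv ℝ f x v) = r ^ 2 * k * inner ℝ x v := by
  obtain ⟨X, hX, u, rfl⟩ := exists_isSphereParam hx
  have h1 : ∀ i, inner ℝ (f (X u)) (fderiv ℝ f (X u) (pd i X u)) = (0 : ℝ) := by
    intro i
    have hd : DifferentiableAt ℝ (fun y => f (X y)) u :=
      (hf.comp hX.contDiff).differentiable (by simp) u
    have h := pd_inner hd hd i
    have hc : (fun y => inner ℝ (f (X y)) (f (X y))) = fun _ => r ^ 2 := funext fun y => by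
      rw [real_inner_self_eq_norm_sq, hr _ (hX.norm_eq y)]
    rw [hc, real_inner_comm (f (X u)), pd_comp (hf.differentiable (by simp) _)
      (hX.differentiableAt u)] at h
    have h0 : pd i (fun _ : Euc m => r ^ 2) u = 0 := by simp [pd]
    linarith
  have h2 : fderiv ℝ f (X u) v = ∑ i, (∑ j, (gram X u)⁻¹ i j * inner ℝ (pd j X u) v) •
      fderiv ℝ f (X u) (pd i X u) + inner ℝ (X u) v • k • f (X u) := by
    conv_lhs => rw [hX.resolution u v]
    simp only [map_add, map_sum, map_smul, hE (X u)]
  rw [h2, inner_add_right, inner_sum]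
  simp only [inner_smul_right, h1, mul_zero, Finset.sum_const_zero, real_inner_self_eq_norm_sq,
    hr _ (hX.norm_eq u)]
  ring

end

theorem pd_pd_smul {W : Type*} [NormedAddCommGroup W] [NormedSpace ℝ W] {q : Euc m → ℝ}
    {f : Euc m → W} (hq : ContDiff ℝ ∞ q) (hf : ContDiff ℝ ∞ f) (x : Euc m) (i j : Fin m) :
    pd i (pd j fun y => q y • f y) x = q x • pd i (pd j f) x + pd i q x • pd j f x
      + pd j q x • pd i f x + pd i (pd j q) x • f x := by
  have hqd : ∀ y, DifferentiableAt ℝ q y := hq.differentiable (by simp)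
  have hfd : ∀ y, DifferentiableAt ℝ f y := hf.differentiable (by simp)
  rw [show pd j (fun y => q y • f y) = fun y => q y • pd j f y + pd j q y • f y from
    funext fun y => pd_smul (hqd y) (hfd y) j,
    pd_add ((hqd x).fun_smul (differentiableAt_pd hf j x))
      ((differentiableAt_pd hq j x).fun_smul (hfd x)),
    pd_smul (hqd x) (differentiableAt_pd hf j x), pd_smul (differentiableAt_pd hq j x) (hfd x)]
  module

section

variable {W : Type*} [NormedAddCommGroup W] [NormedSpace ℝ W]

theorem sphereLaplacian_eq_sum {f : Euc (m + 1) → W} (hf : ContDiff ℝ ∞ f) (x : Euc (m + 1)) :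
    sphereLaplacian f x = ∑ i, pd i (pd i f) x - ∑ i, ∑ j, (x i * x j) • pd i (pd j f) x
      - (m : ℝ) • ∑ i, x i • pd i f x := by
  rw [sphereLaplacian, fderiv_fderiv_eq_sum hf.contDiffAt, fderiv_eq_sum_pd]

theorem sphereLaplacian_add {f g : Euc (m + 1) → W} (hf : ContDiff ℝ ∞ f) (hg : ContDiff ℝ ∞ g)
    (x : Euc (m + 1)) :
    sphereLaplacian (fun y => f y + g y) x = sphereLaplacian f x + sphereLaplacian g x := by
  have h1 : ∀ i, pd i (fun y => f y + g y) = fun y => pd i f y + pd i g y := fun i =>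
    funext fun y => pd_add (hf.differentiable (by simp) y) (hg.differentiable (by simp) y) i
  simp only [sphereLaplacian_eq_sum (hf.add hg), sphereLaplacian_eq_sum hf,
    sphereLaplacian_eq_sum hg, h1,
    pd_add (differentiableAt_pd hf _ x) (differentiableAt_pd hg _ x), smul_add,
    Finset.sum_add_distrib]
  abel

/-- The cross term of the product rule involves only the tangential gradient of `q`: on the unit
sphere, the full gradient with its radial part removed. -/
theorem sphereLaplacian_smul {q : Euc (m + 1) → ℝ} {f : Euc (m + 1) → W} (hq : ContDiff ℝ ∞ q)
    (hf : ContDiff ℝ ∞ f) (x : Euc (m + 1)) :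
    sphereLaplacian (fun y => q y • f y) x = q x • sphereLaplacian f x + sphereLaplacian q x • f x
      + (2 : ℝ) • (fderiv ℝ f x (gradient q x) - fderiv ℝ q x x • fderiv ℝ f x x) := by
  have hqf : ContDiff ℝ ∞ fun y => q y • f y := hq.smul hf
  have h1 : ∀ i, pd i (fun y => q y • f y) x = q x • pd i f x + pd i q x • f x := fun i =>
    pd_smul (hq.differentiable (by simp) x) (hf.differentiable (by simp) x) i
  have h2 : fderiv ℝ q x x • fderiv ℝ f x x = ∑ i, ∑ j, (x i * x j) • pd i q x • pd j f x := by
    rw [fderiv_eq_sum_pd, fderiv_eq_sum_pd, Finset.sum_smul]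
    refine Finset.sum_congr rfl fun i _ => ?_
    rw [Finset.smul_sum]
    refine Finset.sum_congr rfl fun j _ => ?_
    rw [smul_eq_mul]
    module
  have h3 : ∑ i, ∑ j, (x i * x j) • pd j q x • pd i f x =
      ∑ i, ∑ j, (x i * x j) • pd i q x • pd j f x := by
    rw [Finset.sum_comm]
    simp only [mul_comm]
  rw [fderiv_gradient, h2, sphereLaplacian_eq_sum hqf, sphereLaplacian_eq_sum hf,
    sphereLaplacian_eq_sum hq]
  simp only [pd_pd_smul hq hf, h1, smul_add, Finset.sum_add_distrib, h3, smul_comm _ (q x),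
    ← Finset.smul_sum]
  simp only [← smul_assoc, smul_eq_mul, ← Finset.sum_smul]
  module

end

end Sphere

theorem sphereLaplacian_const_smul {m : ℕ} {W : Type*} [NormedAddCommGroup W] [NormedSpace ℝ W]
    {f : Euc (m + 1) → W} (hf : ContDiff ℝ ∞ f) (c : ℝ) (x : Euc (m + 1)) :
    sphereLaplacian (fun y => c • f y) x = c • sphereLaplacian f x := by
  have h1 : ∀ i, pd i (fun y => c • f y) = fun y => c • pd i f y := fun i =>
    funext fun y => pd_const_smul c (hf.differentiable (by simp) y) i
  simp only [sphereLaplacian_eq_sum (hf.const_smul c), sphereLaplacian_eq_sum hf, h1,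
    pd_const_smul c (differentiableAt_pd hf _ x), smul_sub, Finset.smul_sum, smul_comm c]

/-! ### Compatibility of the operators with pairs of maps. -/

section Join

variable {n₁ n₂ : ℕ}

theorem join_add (a a' : Euc (n₁ + 1)) (b b' : Euc (n₂ + 1)) :
    join (a + a') (b + b') = join a b + join a' b' := by
  ext i
  simp only [join, PiLp.add_apply]
  induction Fin.cast (show n₁ + n₂ + 1 + 1 = (n₁ + 1) + (n₂ + 1) by omega) i using Fin.addCases with
  | left j => simp only [Fin.append_left]
  | right j => simp only [Fin.append_right]

theorem join_smul (c : ℝ) (a : Euc (n₁ + 1)) (b : Euc (n₂ + 1)) :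
    join (c • a) (c • b) = c • join a b := by
  ext i
  simp only [join, PiLp.smul_apply]
  induction Fin.cast (show n₁ + n₂ + 1 + 1 = (n₁ + 1) + (n₂ + 1) by omega) i using Fin.addCases with
  | left j => simp only [Fin.append_left]
  | right j => simp only [Fin.append_right]

theorem inner_join (a a' : Euc (n₁ + 1)) (b b' : Euc (n₂ + 1)) :
    inner ℝ (join a b) (join a' b') = inner ℝ a a' + inner ℝ b b' := by
  have h := norm_join_sq (a + a') (b + b')
  rw [join_add, norm_add_sq_real, norm_add_sq_real, norm_add_sq_real, norm_join_sq,
    norm_join_sq] at h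
  linarith

/-- The inclusion `a ↦ (a, 0)`. -/
noncomputable def joinLeft (n₁ n₂ : ℕ) : Euc (n₁ + 1) →L[ℝ] Euc (n₁ + n₂ + 1 + 1) :=
  LinearMap.toContinuousLinearMap
    { toFun := fun a => join a 0
      map_add' := fun a a' => by rw [← join_add, add_zero]
      map_smul' := fun c a => by rw [RingHom.id_apply, ← join_smul, smul_zero] }

/-- The inclusion `b ↦ (0, b)`. -/
noncomputable def joinRight (n₁ n₂ : ℕ) : Euc (n₂ + 1) →L[ℝ] Euc (n₁ + n₂ + 1 + 1) :=
  LinearMap.toContinuousLinearMap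
    { toFun := fun b => join 0 b
      map_add' := fun b b' => by rw [← join_add, add_zero]
      map_smul' := fun c b => by rw [RingHom.id_apply, ← join_smul, smul_zero] }

theorem join_eq (a : Euc (n₁ + 1)) (b : Euc (n₂ + 1)) :
    join a b = joinLeft n₁ n₂ a + joinRight n₁ n₂ b := by
  change _ = join a 0 + join 0 b
  rw [← join_add, add_zero, zero_add]

variable {m : ℕ} {F₁ : Euc m → Euc (n₁ + 1)} {F₂ : Euc m → Euc (n₂ + 1)}

theorem contDiff_join (h₁ : ContDiff ℝ ∞ F₁) (h₂ : ContDiff ℝ ∞ F₂) :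
    ContDiff ℝ ∞ fun y => join (F₁ y) (F₂ y) := by
  simp only [join_eq]
  exact ((joinLeft n₁ n₂).contDiff.comp h₁).add ((joinRight n₁ n₂).contDiff.comp h₂)

theorem pd_join (h₁ : ContDiff ℝ ∞ F₁) (h₂ : ContDiff ℝ ∞ F₂) (i : Fin m) :
    pd i (fun y => join (F₁ y) (F₂ y)) = fun y => join (pd i F₁ y) (pd i F₂ y) := by
  funext x
  have hd₁ := h₁.differentiable (by simp) x
  have hd₂ := h₂.differentiable (by simp) x
  have hl₁ : DifferentiableAt ℝ (fun y => joinLeft n₁ n₂ (F₁ y)) x :=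
    (joinLeft n₁ n₂).differentiableAt.comp x hd₁
  have hl₂ : DifferentiableAt ℝ (fun y => joinRight n₁ n₂ (F₂ y)) x :=
    (joinRight n₁ n₂).differentiableAt.comp x hd₂
  simp only [join_eq]
  rw [pd_add hl₁ hl₂]
  exact congrArg₂ (· + ·) (pd_clm_comp _ hd₁ i) (pd_clm_comp _ hd₂ i)

theorem sum_smul_join {ι : Type*} [Fintype ι] (c : ι → ℝ) (a : ι → Euc (n₁ + 1))
    (b : ι → Euc (n₂ + 1)) :
    ∑ i, c i • join (a i) (b i) = join (∑ i, c i • a i) (∑ i, c i • b i) := by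
  simp only [join_eq, smul_add, Finset.sum_add_distrib, map_sum, map_smul]

theorem fderiv_join (h₁ : ContDiff ℝ ∞ F₁) (h₂ : ContDiff ℝ ∞ F₂) (x v : Euc m) :
    fderiv ℝ (fun y => join (F₁ y) (F₂ y)) x v = join (fderiv ℝ F₁ x v) (fderiv ℝ F₂ x v) := by
  simp only [fderiv_eq_sum_pd, pd_join h₁ h₂, sum_smul_join]

theorem lap_join (h₁ : ContDiff ℝ ∞ F₁) (h₂ : ContDiff ℝ ∞ F₂) :
    lap (fun y => join (F₁ y) (F₂ y)) = fun y => join (lap F₁ y) (lap F₂ y) := by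
  funext x
  rw [lap_apply (contDiff_join h₁ h₂), lap_apply h₁, lap_apply h₂]
  simp only [pd_join h₁ h₂, pd_join (contDiff_pd h₁ _) (contDiff_pd h₂ _)]
  simp only [join_eq, map_neg, map_sum, Finset.sum_add_distrib]
  abel

theorem normSqD_join (h₁ : ContDiff ℝ ∞ F₁) (h₂ : ContDiff ℝ ∞ F₂) :
    normSqD (fun y => join (F₁ y) (F₂ y)) = fun y => normSqD F₁ y + normSqD F₂ y := by
  funext x
  simp only [normSqD, pd_join h₁ h₂, norm_join_sq, Finset.sum_add_distrib]

theorem normSqHess_join (h₁ : ContDiff ℝ ∞ F₁) (h₂ : ContDiff ℝ ∞ F₂) (x : Euc m) :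
    normSqHess (fun y => join (F₁ y) (F₂ y)) x = normSqHess F₁ x + normSqHess F₂ x := by
  simp only [normSqHess, pd_join h₁ h₂, pd_join (contDiff_pd h₁ _) (contDiff_pd h₂ _), norm_join_sq,
    Finset.sum_add_distrib]

theorem sphereLaplacian_join {F₁ : Euc (m + 1) → Euc (n₁ + 1)} {F₂ : Euc (m + 1) → Euc (n₂ + 1)}
    (h₁ : ContDiff ℝ ∞ F₁) (h₂ : ContDiff ℝ ∞ F₂) (x : Euc (m + 1)) :
    sphereLaplacian (fun y => join (F₁ y) (F₂ y)) x =
      join (sphereLaplacian F₁ x) (sphereLaplacian F₂ x) := by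
  rw [sphereLaplacian_eq_sum (contDiff_join h₁ h₂), sphereLaplacian_eq_sum h₁,
    sphereLaplacian_eq_sum h₂]
  simp only [pd_join h₁ h₂, pd_join (contDiff_pd h₁ _) (contDiff_pd h₂ _)]
  simp only [join_eq, map_sub, map_sum, map_smul, smul_add, Finset.sum_add_distrib]
  abel

end Join

/-! ### Iterated Laplacian of a form, and comparison modulo a unit vector. -/

section Forms

variable {m : ℕ} {W : Type*} [NormedAddCommGroup W] [NormedSpace ℝ W] {k : ℝ}

/-- Since Δf has degree k-2, its coefficient is the sum k(k+m-1) + (k-2)(k+m-3) of the two radial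
constants. -/
theorem sphereLaplacian_sphereLaplacian {f : Euc (m + 1) → W} (hE : IsEuler k f)
    (hf : ContDiff ℝ ∞ f) (x : Euc (m + 1)) :
    sphereLaplacian (fun y => -lap f y - (k * (k + m - 1)) • f y) x =
      lap (lap f) x + (2 * (m * k + k ^ 2 - 3 * k - m + 3)) • lap f x
        + (k ^ 2 * (m + k - 1) ^ 2) • f x := by
  have h : (fun y => -lap f y - (k * (k + m - 1)) • f y) =
      fun y => (-1 : ℝ) • lap f y + (-(k * (k + m - 1))) • f y := by
    funext y
    module
  rw [h, sphereLaplacian_add ((contDiff_lap hf).const_smul _) (hf.const_smul _),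
    sphereLaplacian_const_smul (contDiff_lap hf), sphereLaplacian_const_smul hf,
    sphereLaplacian_of_isEuler hE hf,
    sphereLaplacian_of_isEuler (isEuler_lap hE hf) (contDiff_lap hf)]
  module

theorem inner_gradient_right (q : Euc m → ℝ) (x v : Euc m) :
    inner ℝ v (gradient q x) = fderiv ℝ q x v := by
  rw [real_inner_comm]
  simp [gradient]

theorem fderiv_gradient_sub_const (f : Euc m → W) (q : Euc m → ℝ) (c : ℝ) (x : Euc m) :
    fderiv ℝ f x (gradient (fun y => q y - c) x) = fderiv ℝ f x (gradient q x) := by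
  rw [gradient, gradient, fderiv_sub_const]

theorem lap_add {f g : Euc m → W} (hf : ContDiff ℝ ∞ f) (hg : ContDiff ℝ ∞ g) (x : Euc m) :
    lap (fun y => f y + g y) x = lap f x + lap g x := by
  have h2 : (2 : ℕ∞ω) ≤ ∞ := WithTop.coe_le_coe.2 (le_top : (2 : ℕ∞) ≤ ⊤)
  have h := (hf.contDiffAt (x := x).of_le h2).laplacian_add (hg.contDiffAt.of_le h2)
  simp only [lap, Pi.neg_apply]
  rw [← neg_add, ← h]
  rfl

/-- This removes the undetermined normal component: the value of `t` need not be known beforehand.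
-/
theorem eq_of_inner_eq_zero {V : Type*} [NormedAddCommGroup V] [InnerProductSpace ℝ V]
    {v w e : V} {t : ℝ} (h : v = w + t • e) (hv : inner ℝ e v = (0 : ℝ))
    (hw : inner ℝ e w = (0 : ℝ)) (he : ‖e‖ = 1) : v = w := by
  rw [h, inner_add_right, hw, inner_smul_right, real_inner_self_eq_norm_sq, he] at hv
  have ht : t = 0 := by linarith
  rw [h, ht, zero_smul, add_zero]

end Forms

end BiharmonicForms

/-! ### The bitension field of a diagonal map of forms. -/

theorem mainTheorem5 (m n₁ n₂ k₁ k₂ : ℕ) (r₁ r₂ : ℝ) (hr₁ : 0 < r₁) (hr₂ : 0 < r₂)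
    (hr : r₁ ^ 2 + r₂ ^ 2 = 1)
    (F₁ : Euc (m + 1) → Euc (n₁ + 1))
    (F₂ : Euc (m + 1) → Euc (n₂ + 1))
    (hF₁ : IsForm k₁ F₁) (hF₂ : IsForm k₂ F₂)
    (φ₁ : Sph m → Metric.sphere (0 : Euc (n₁ + 1)) r₁)
    (φ₂ : Sph m → Metric.sphere (0 : Euc (n₂ + 1)) r₂)
    (hφ₁ : ∀ q, (φ₁ q : Euc (n₁ + 1)) = F₁ q)
    (hφ₂ : ∀ q, (φ₂ q : Euc (n₂ + 1)) = F₂ q)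
    (φ : Sph m → Sph (n₁ + n₂ + 1))
    (hφ : φ = fun q => prodIncl hr (φ₁ q, φ₂ q))
    (F : Euc (m + 1) → Euc (n₁ + n₂ + 1 + 1))
    (hF : F = fun y => join (F₁ y) (F₂ y))
    (p : Sph m) (x : Euc (m + 1)) (hx : x = p) :
    dIncl (φ p)
        (bitensionField (roundMetric m)
          (roundMetric (n₁ + n₂ + 1)) φ p) =
      lap (lap F) x
      + join
          ((2 * ((m : ℝ) * k₁ + (k₁ : ℝ) ^ 2 - 3 * k₁ - m + 3)) • lap F₁ x
            + ((k₁ : ℝ) ^ 2 * ((m : ℝ) + k₁ - 1) ^ 2) • F₁ x)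
          ((2 * ((m : ℝ) * k₂ + (k₂ : ℝ) ^ 2 - 3 * k₂ - m + 3)) • lap F₂ x
            + ((k₂ : ℝ) ^ 2 * ((m : ℝ) + k₂ - 1) ^ 2) • F₂ x)
      + (2 * (normSqD F x - (k₁ : ℝ) ^ 2 * r₁ ^ 2 - (k₂ : ℝ) ^ 2 * r₂ ^ 2)) •
          join
            (-lap F₁ x + ((k₁ : ℝ) * (1 - m - k₁)) • F₁ x)
            (-lap F₂ x + ((k₂ : ℝ) * (1 - m - k₂)) • F₂ x)
      + (-2 * lap (normSqD F) x
          - 2 * normSqHess F x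
          + ‖lap F x‖ ^ 2
          + 2 * ((m : ℝ) + 2 * k₁ - 3) * normSqD F₁ x
          + 2 * ((m : ℝ) + 2 * k₂ - 3) * normSqD F₂ x
          - r₁ ^ 2 * (k₁ : ℝ) ^ 2
            * ((m : ℝ) ^ 2 + 4 * m * k₁ - 6 * m + 5 * (k₁ : ℝ) ^ 2 - 12 * k₁ + 5)
          - 2 * (k₁ : ℝ) * ((m : ℝ) + k₁ - 1) * normSqD F₁ x
          - r₂ ^ 2 * (k₂ : ℝ) ^ 2
            * ((m : ℝ) ^ 2 + 4 * m * k₂ - 6 * m + 5 * (k₂ : ℝ) ^ 2 - 12 * k₂ + 5)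
          - 2 * (k₂ : ℝ) * ((m : ℝ) + k₂ - 1) * normSqD F₂ x
          + 2 * (normSqD F x
              - (k₁ : ℝ) ^ 2 * r₁ ^ 2 - (k₂ : ℝ) ^ 2 * r₂ ^ 2) ^ 2) • F x
      + (2 : ℝ) • fderiv ℝ F x (gradient (normSqD F) x)
      - (4 * (((k₁ : ℝ) - 1) * normSqD F₁ x
          + ((k₂ : ℝ) - 1) * normSqD F₂ x)) •
          join ((k₁ : ℝ) • F₁ x) ((k₂ : ℝ) • F₂ x) := by
  have hs₁ := hF₁.contDiff
  have hs₂ := hF₂.contDiff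
  have hE₁ := hF₁.isEuler
  have hE₂ := hF₂.isEuler
  have hs : ContDiff ℝ ∞ F := hF ▸ contDiff_join hs₁ hs₂
  have hn₁ : ∀ y, ‖y‖ = 1 → ‖F₁ y‖ = r₁ := fun y hy => by
    rw [← mem_sphere_zero_iff_norm.1 (φ₁ ⟨y, mem_sphere_zero_iff_norm.2 hy⟩).2, hφ₁]
  have hn₂ : ∀ y, ‖y‖ = 1 → ‖F₂ y‖ = r₂ := fun y hy => by
    rw [← mem_sphere_zero_iff_norm.1 (φ₂ ⟨y, mem_sphere_zero_iff_norm.2 hy⟩).2, hφ₂]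
  have hx1 : ‖x‖ = 1 := hx ▸ mem_sphere_zero_iff_norm.1 p.2
  have hφF : ∀ q, (φ q : Euc (n₁ + n₂ + 1 + 1)) = F q := fun q => by
    simp only [hφ, hF, prodIncl, hφ₁, hφ₂]
  -- On the unit sphere `c` is the squared radial derivative of `F`, so the energy density there is
  -- `normSqD F - c`. The extension of the tension field has to be right only on the sphere, so the
  -- constant may be used everywhere.
  set c : ℝ := (k₁ : ℝ) ^ 2 * r₁ ^ 2 + (k₂ : ℝ) ^ 2 * r₂ ^ 2 with hc
  have hdF : ∀ y, fderiv ℝ F y y = join ((k₁ : ℝ) • F₁ y) ((k₂ : ℝ) • F₂ y) := fun y => by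
    rw [hF, fderiv_join hs₁ hs₂, hE₁, hE₂]
  have hdFn : ∀ y, ‖y‖ = 1 → ‖fderiv ℝ F y y‖ ^ 2 = c := fun y hy => by
    rw [hdF, norm_join_sq, norm_smul, norm_smul, hn₁ y hy, hn₂ y hy, mul_pow, mul_pow,
      Real.norm_eq_abs, Real.norm_eq_abs, sq_abs, sq_abs]
  -- an extension of the tension field to the ambient space
  let A₁ : Euc (m + 1) → Euc (n₁ + 1) := fun y => -lap F₁ y - ((k₁ : ℝ) * (k₁ + m - 1)) • F₁ y
  let A₂ : Euc (m + 1) → Euc (n₂ + 1) := fun y => -lap F₂ y - ((k₂ : ℝ) * (k₂ + m - 1)) • F₂ y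
  have hA₁ : ContDiff ℝ ∞ A₁ := (contDiff_lap hs₁).neg.sub (hs₁.const_smul _)
  have hA₂ : ContDiff ℝ ∞ A₂ := (contDiff_lap hs₂).neg.sub (hs₂.const_smul _)
  have hq : ContDiff ℝ ∞ fun y => normSqD F y - c := (contDiff_normSqD hs).sub contDiff_const
  have hqF : ContDiff ℝ ∞ fun y => (normSqD F y - c) • F y := hq.smul hs
  have hSF : ∀ y, sphereLaplacian F y = join (A₁ y) (A₂ y) := fun y => by
    rw [hF, sphereLaplacian_join hs₁ hs₂, sphereLaplacian_of_isEuler hE₁ hs₁,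
      sphereLaplacian_of_isEuler hE₂ hs₂]
  obtain ⟨horth, s, hB⟩ := dIncl_bitensionField (T := fun y => join (A₁ y) (A₂ y)
    + (normSqD F y - c) • F y) hs hφF ((contDiff_join hA₁ hA₂).add hqF)
    (fun y hy => by rw [hdFn y hy, hSF]) p
  have hdq : fderiv ℝ (normSqD F) x x =
      2 * ((k₁ : ℝ) - 1) * normSqD F₁ x + 2 * ((k₂ : ℝ) - 1) * normSqD F₂ x := by
    rw [hF, normSqD_join hs₁ hs₂, fderiv_fun_add
      ((contDiff_normSqD hs₁).differentiable (by simp) x)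
      ((contDiff_normSqD hs₂).differentiable (by simp) x), add_apply,
      isEuler_normSqD hE₁ hs₁, isEuler_normSqD hE₂ hs₂, smul_eq_mul, smul_eq_mul]
  rw [← hx] at horth hB
  rw [sphereLaplacian_add (contDiff_join hA₁ hA₂) hqF, sphereLaplacian_smul hq hs,
    sphereLaplacian_join hA₁ hA₂, sphereLaplacian_sphereLaplacian hE₁ hs₁,
    sphereLaplacian_sphereLaplacian hE₂ hs₂, hdFn x hx1, hSF, fderiv_gradient_sub_const,
    fderiv_sub_const, hdq, hdF] at hB
  set v := gradient (normSqD F) x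
  have hv : inner ℝ (F x) (fderiv ℝ F x v) = (r₁ ^ 2 * k₁ + r₂ ^ 2 * k₂) *
      (2 * ((k₁ : ℝ) - 1) * normSqD F₁ x + 2 * ((k₂ : ℝ) - 1) * normSqD F₂ x) := by
    rw [hF, fderiv_join hs₁ hs₂, inner_join, inner_fderiv_of_norm_eq hE₁ hs₁ hn₁ hx1,
      inner_fderiv_of_norm_eq hE₂ hs₂ hn₂ hx1, inner_gradient_right, hdq]
    ring
  have hLF : lap F = fun y => join (lap F₁ y) (lap F₂ y) := by rw [hF, lap_join hs₁ hs₂]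
  have hLLF : lap (lap F) x = join (lap (lap F₁) x) (lap (lap F₂) x) := by
    rw [hLF, lap_join (contDiff_lap hs₁) (contDiff_lap hs₂)]
  have hD : normSqD F x = normSqD F₁ x + normSqD F₂ x := by rw [hF, normSqD_join hs₁ hs₂]
  have hLD : lap (normSqD F) x = lap (normSqD F₁) x + lap (normSqD F₂) x := by
    rw [hF, normSqD_join hs₁ hs₂, lap_add (contDiff_normSqD hs₁) (contDiff_normSqD hs₂)]
  have hH : normSqHess F x = normSqHess F₁ x + normSqHess F₂ x := by
    rw [hF, normSqHess_join hs₁ hs₂]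
  have hLn : ‖lap F x‖ ^ 2 = ‖lap F₁ x‖ ^ 2 + ‖lap F₂ x‖ ^ 2 := by rw [hLF, norm_join_sq]
  have hFx : F x = join (F₁ x) (F₂ x) := by rw [hF]
  have hFn : ‖F x‖ = 1 := by
    have h := norm_join_sq (F₁ x) (F₂ x)
    rw [hn₁ x hx1, hn₂ x hx1, hr, ← hFx] at h
    nlinarith [norm_nonneg (F x)]
  refine eq_of_inner_eq_zero (t := ?_) ?_ horth ?_ hFn
  -- The coefficient of `F x` found in `hB`, minus the claimed one.
  · exact sphereLaplacian (fun y => normSqD F y - c) x + (normSqD F x - c) ^ 2 + s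
      - (-2 * lap (normSqD F) x - 2 * normSqHess F x + ‖lap F x‖ ^ 2
          + 2 * ((m : ℝ) + 2 * k₁ - 3) * normSqD F₁ x
          + 2 * ((m : ℝ) + 2 * k₂ - 3) * normSqD F₂ x
          - r₁ ^ 2 * (k₁ : ℝ) ^ 2
            * ((m : ℝ) ^ 2 + 4 * m * k₁ - 6 * m + 5 * (k₁ : ℝ) ^ 2 - 12 * k₁ + 5)
          - 2 * (k₁ : ℝ) * ((m : ℝ) + k₁ - 1) * normSqD F₁ x
          - r₂ ^ 2 * (k₂ : ℝ) ^ 2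
            * ((m : ℝ) ^ 2 + 4 * m * k₂ - 6 * m + 5 * (k₂ : ℝ) ^ 2 - 12 * k₂ + 5)
          - 2 * (k₂ : ℝ) * ((m : ℝ) + k₂ - 1) * normSqD F₂ x
          + 2 * (normSqD F x - (k₁ : ℝ) ^ 2 * r₁ ^ 2 - (k₂ : ℝ) ^ 2 * r₂ ^ 2) ^ 2)
  · rw [hB, hLLF]
    simp only [A₁, A₂, join_eq, map_add, map_sub, map_neg, map_smul]
    generalize sphereLaplacian (fun y => normSqD F y - c) x = Q
    rw [hc]
    module
  -- Orthogonality of the claimed right-hand side to `F x`: after substituting the products of each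
  -- `F i` with its Laplacians and derivative, the pairing is a polynomial identity. In this pairing
  -- r₁² + r₂² = 1 enters only through `hFn`.
  · simp only [inner_sub_right, inner_add_right, inner_smul_right, hv, real_inner_self_eq_norm_sq,
      hFn]
    rw [hLLF, hFx]
    simp only [inner_join, inner_add_right, inner_neg_right, inner_smul_right,
      inner_lap_of_norm_eq hE₁ hs₁ hn₁ hx1, inner_lap_of_norm_eq hE₂ hs₂ hn₂ hx1,
      inner_lap_lap_of_norm_eq hE₁ hs₁ hn₁ hx1, inner_lap_lap_of_norm_eq hE₂ hs₂ hn₂ hx1,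
      real_inner_self_eq_norm_sq, hn₁ x hx1, hn₂ x hx1, hD, hLD, hH, hLn]
    ring
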